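/- Let $\mathcal L=\{(n,m)\in\mathbb Z^2: n\ge 0,\ n+m \text{ even}\}$ and $o=(0,0)$. Fix $p\in[0,1]$ and let the sites of $\mathcal L$ be independently open with probability $p$ and closed otherwise. An open site $(n,m)$ connects to each of $(n+1,m+1)$, $(n+2,m)$, $(n+1,m-1)$; a closed site connects to nothing. Write $x\to y$ if there is a path of such connections (possibly of length $0$) from $x$ to $y$, and $\mathbf C_x=\{y: x\to y\}$. For $n\ge1$ let $$\overline u_n=\sup\{x:\ \exists y\le 0 \text{ with } (0,y)\to(n,x)\text{ or }(1,y)\to(n,x)\},\qquad \alpha[p]=\inf_{n\ge 1}\mathbb E\Big[\frac{\overline u_n}{n}\Big]\in[-\infty,1]$$ (all points being in $\mathcal L$). Let $0<\delta<0.25$ and $0<\alpha\le 1$. Call $L$ admissible if $L$ is a positive even integer and $(1-\delta)\alpha L$ is an even integer. For admissible $L$ and $z=(n,m)\in\mathcal L$ put $C_z=(Ln,(1-\delta)\alpha Lm)$. Let $A_z$ be $C_z$ plus the parallelogram with vertices $(0,-\frac32\delta\alpha L)$, $(0,-\frac12\delta\alpha L)$, $((1+\delta)L,(1-\frac\delta2)\alpha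 L)$, $((1+\delta)L,(1+\frac\delta2)\alpha L)$, and let $B_z$ be the reflection of $A_z$ in the horizontal line through $C_z$. Let $H^{\nearrow}_z$ be the event that there is an open path all of whose vertices lie in $A_z$, which starts, in coordinates relative to $C_z$, at a site $(0,k)$ or $(1,k)$ with $k\in[-\frac32\delta\alpha L,-\frac12\delta\alpha L]$ and ends at a site with relative first coordinate $\lfloor(1+\delta)L\rfloor$. Let $H^{\searrow}_z$ be the mirror-image event for $B_z$ (with $k\in[\frac12\delta\alpha L,\frac32\delta\alpha L]$). Put $\eta(z)=1$ if $H^{\nearrow}_z\cap H^{\searrow}_z$ occurs and $\eta(z)=0$ otherwise. In the $\eta$-system a site $(n,m)\in\mathcal L$ with $\eta(n,m)=1$ connects to $(n+1,m+1)$ and $(n+1,m-1)$; the system percolates if infinitely many sites can be reached from $o$ along such connections. Let $d$ be the graph distance on $\mathcal L$ for the graph in which each $z$ is adjacent to those of $z+(\pm1,\pm1)$, $z+(0,\pm2)$ that lie in $\mathcal L$ (at most six sites). Then the following hold. (i) For every admissible $L$ the variables $\eta(z)$ are $1$-dependent: if $d(z_i,z_j)>1$ for all $i\ne j$ in $\{1,\dots,m\}$,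 then $\eta(z_1),\dots,\eta(z_m)$ are independent. Moreover each $\eta(z)$ is independent of the whole family $(\eta(z'))_{d(z,z')>1}$, that is, of all but at most $6$ other variables. (ii) For every admissible $L$, if the $\eta$-system percolates then $|\mathbf C_{(0,k)}|=\infty$ or $|\mathbf C_{(1,k)}|=\infty$ for some $k\in[-\frac32\delta\alpha L,-\frac12\delta\alpha L]$ (with $(0,k)$, respectively $(1,k)$, in $\mathcal L$). (iii) If $\alpha=\alpha[p]$ (so that $\alpha[p]>0$), then for every $\epsilon>0$ there is $L_0$ such that $P(\eta(z)=1)>1-\epsilon$ for all admissible $L\ge L_0$ and all $z\in\mathcal L$. -/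

import Mathlib

open MeasureTheory ProbabilityTheory
open scoped ENNReal

noncomputable section

namespace OTSP

/-! ### Oriented site percolation on the triangular lattice -/

/-- The half-plane lattice of all `(n, m)` in `ℤ²` with `n ≥ 0` and `n + m` even. -/
abbrev Site : Type := {z : ℤ × ℤ // 0 ≤ z.1 ∧ Even (z.1 + z.2)}

/-- The origin `(0, 0)`. -/
def origin : Site := ⟨(0, 0), by simp⟩

/-- A percolation configuration: `ω z = true` means that the site `z` is open (occupied). -/
abbrev Config : Type := Site → Bool

/-- The sites are independently open with probability `p` and closed with probability `1 - p`. -/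
def law (p : unitInterval) : Measure Config :=
  Measure.infinitePi fun _ : Site => bernoulliMeasure true false p

/-- The directed edges present in `ω`: an open site `(n, m)` connects to each of
`(n + 1, m + 1)`, `(n + 2, m)` and `(n + 1, m - 1)`; a closed site connects to nothing. -/
def Step (ω : Config) (a b : Site) : Prop :=
  ω a = true ∧
    (b.1 = (a.1.1 + 1, a.1.2 + 1) ∨ b.1 = (a.1.1 + 2, a.1.2) ∨ b.1 = (a.1.1 + 1, a.1.2 - 1))

/-- `a → b`: there is an open path, possibly of length zero, from `a` to `b`. -/
def Conn (ω : Config) (a b : Site) : Prop :=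
  Relation.ReflTransGen (Step ω) a b

/-- There is an open path from `a` to `b` all of whose vertices lie in `S`. -/
def ConnIn (ω : Config) (S : Set Site) (a b : Site) : Prop :=
  a ∈ S ∧ Relation.ReflTransGen (fun x y => Step ω x y ∧ y ∈ S) a b

/-- The forward cluster of the site `a`. -/
def cluster (ω : Config) (a : Site) : Set Site := {b | Conn ω a b}

/-! ### The asymptotic slope -/

/-- The heights at level `n` reachable from some `(0, y)` or `(1, y)` with `y ≤ 0`. -/
def xiBar (ω : Config) (n : ℕ) : Set ℤ :=
  {x | ∃ a b : Site, (a.1.1 = 0 ∨ a.1.1 = 1) ∧ a.1.2 ≤ 0 ∧ b.1 = ((n : ℤ), x) ∧ Conn ω a b}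

/-- The supremum of `xiBar ω n`, which is `-∞` if that set is empty. -/
def uBar (ω : Config) (n : ℕ) : EReal :=
  sSup ((fun x : ℤ => ((x : ℝ) : EReal)) '' xiBar ω n)

/-- Expectation of an extended real random variable, `𝔼[f⁺] - 𝔼[f⁻]`.
It is used only where `f` is bounded above, so that `𝔼[f⁺]` is finite. -/
def expect (μ : Measure Config) (f : Config → EReal) : EReal :=
  ((∫⁻ ω, (f ω).toENNReal ∂μ : ℝ≥0∞) : EReal) - ((∫⁻ ω, (-f ω).toENNReal ∂μ : ℝ≥0∞) : EReal)

/-- The asymptotic slope `α[p]`, the infimum over `n ≥ 1` of the expectations of `uBar n / n`.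
The value `-∞` is possible. -/
def slope (p : unitInterval) : EReal :=
  ⨅ n : ℕ, ⨅ _ : 1 ≤ n, expect (law p) fun ω => uBar ω n / (n : EReal)

/-! ### The block construction -/

/-- `L` is an admissible scale: a positive even integer such that `(1 - δ) α L` is an even integer
as well. -/
def Admissible (δ α : ℝ) (L : ℕ) : Prop :=
  0 < L ∧ Even L ∧ ∃ k : ℤ, Even k ∧ (1 - δ) * α * L = k

/-- The horizontal coordinate of the site `a` relative to the base point
`(L n, (1 - δ) α L m)` of the block `z = (n, m)`. -/
def relX (L : ℕ) (z a : Site) : ℤ := a.1.1 - L * z.1.1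

/-- The vertical coordinate of the site `a` relative to the base point
`(L n, (1 - δ) α L m)` of the block `z = (n, m)`. -/
def relY (δ α : ℝ) (L : ℕ) (z a : Site) : ℝ := a.1.2 - (1 - δ) * α * L * z.1.2

/-- The sites of the rising parallelogram of the block `z`. In coordinates relative to the base
point of the block its vertices are
`(0, -(3/2) δ α L)`, `((1 + δ) L, (1 - δ/2) α L)`,
`(0, -(1/2) δ α L)`, `((1 + δ) L, (1 + δ/2) α L)`,
so that its two long sides have slope `α`. -/
def up (δ α : ℝ) (L : ℕ) (z : Site) : Set Site :=
  {a | 0 ≤ relX L z a ∧ (relX L z a : ℝ) ≤ (1 + δ) * L ∧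
    -(3 / 2) * δ * α * L ≤ relY δ α L z a - α * relX L z a ∧
    relY δ α L z a - α * relX L z a ≤ -(1 / 2) * δ * α * L}

/-- The sites of the falling parallelogram of the block `z`, the mirror image of the rising one in
the horizontal line through the base point. -/
def down (δ α : ℝ) (L : ℕ) (z : Site) : Set Site :=
  {a | 0 ≤ relX L z a ∧ (relX L z a : ℝ) ≤ (1 + δ) * L ∧
    -(3 / 2) * δ * α * L ≤ -relY δ α L z a - α * relX L z a ∧
    -relY δ α L z a - α * relX L z a ≤ -(1 / 2) * δ * α * L}

/-- There is an open path from left to right that stays in the rising parallelogram. It starts at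
relative first coordinate `0` or `1`, at a height in the range of the left side of the
parallelogram, and ends at relative first coordinate `(1 + δ) L`, rounded down. -/
def upCrossing (δ α : ℝ) (L : ℕ) (z : Site) (ω : Config) : Prop :=
  ∃ a b : Site, (relX L z a = 0 ∨ relX L z a = 1) ∧
    -(3 / 2) * δ * α * L ≤ relY δ α L z a ∧ relY δ α L z a ≤ -(1 / 2) * δ * α * L ∧
    relX L z b = ⌊(1 + δ) * (L : ℝ)⌋ ∧ ConnIn ω (up δ α L z) a b

/-- There is an open path from left to right that stays in the falling parallelogram. -/
def downCrossing (δ α : ℝ) (L : ℕ) (z : Site) (ω : Config) : Prop :=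
  ∃ a b : Site, (relX L z a = 0 ∨ relX L z a = 1) ∧
    (1 / 2) * δ * α * L ≤ relY δ α L z a ∧ relY δ α L z a ≤ (3 / 2) * δ * α * L ∧
    relX L z b = ⌊(1 + δ) * (L : ℝ)⌋ ∧ ConnIn ω (down δ α L z) a b

/-- The block event of `z`: both crossings occur. -/
def goodBlock (δ α : ℝ) (L : ℕ) (z : Site) : Set Config :=
  {ω | upCrossing δ α L z ω ∧ downCrossing δ α L z ω}

/-- The random variable `η(z)`, the indicator of the block event. -/
def eta (δ α : ℝ) (L : ℕ) (z : Site) (ω : Config) : ℕ :=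
  (goodBlock δ α L z).indicator (fun _ => 1) ω

/-- The directed edges of the block system: those of the square lattice on `Site`, from `(n, m)` to
`(n + 1, m + 1)` and `(n + 1, m - 1)`, that issue from a site with `η = 1`. -/
def EtaStep (δ α : ℝ) (L : ℕ) (ω : Config) (a b : Site) : Prop :=
  eta δ α L a ω = 1 ∧ (b.1 = (a.1.1 + 1, a.1.2 + 1) ∨ b.1 = (a.1.1 + 1, a.1.2 - 1))

/-- The cluster of the origin in the block system. -/
def etaCluster (δ α : ℝ) (L : ℕ) (ω : Config) : Set Site :=
  {b | Relation.ReflTransGen (EtaStep δ α L ω) origin b}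

/-- The neighbour graph for the dependence between blocks: the square lattice on `Site`, whose edges
are the translates by `(±1, ±1)`, with the translates by `(0, ±2)` added. -/
def blockGraph : SimpleGraph Site where
  Adj a b := (|a.1.1 - b.1.1| = 1 ∧ |a.1.2 - b.1.2| = 1) ∨
    (a.1.1 = b.1.1 ∧ |a.1.2 - b.1.2| = 2)
  symm := ⟨fun a b h => by
    rcases h with ⟨h1, h2⟩ | ⟨h1, h2⟩
    · exact Or.inl ⟨by rwa [abs_sub_comm], by rwa [abs_sub_comm]⟩
    · exact Or.inr ⟨h1.symm, by rwa [abs_sub_comm]⟩⟩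
  loopless := ⟨fun a h => by simp at h⟩

end OTSP

end

noncomputable section

namespace OTSP

/-! ### Events determined by the sites of a set -/

/-! Parts (i) and (ii) are deterministic geometry on top of the independence of sites. The variable
`η(z)` depends only on the sites of its two parallelograms, and for `δ < 1/4` these sets are
disjoint for blocks that are neither equal nor adjacent (`disjoint_blocks`). This gives (i).

For (ii) the point is planarity: two paths that change their vertical order share a site, in spite
of the jumps `(2, 0)` (`IsTrack.meet`). A rising parallelogram ends inside the next block up, where
it cuts the falling one near its left side. That falling path in turn cuts the rising crossing of
the same block. Hence a path that arrives at a good block can switch to both of its crossings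
(`meet_next_block`, `meet_in_block`), and this property is inherited along the block system
(`Feeds.next`).

Part (iii) rests on an exponential upper tail for the right edge `u_n`. Restarting at level `m` from
below the edge makes the exponential moments submultiplicative (`edgeMoment_add_le`). Since the
slope is an infimum, some level has mean rate below `α + γ`, and a small exponent then bounds all
later moments; Chernoff's inequality gives `exists_edgeGE_le`. Conversely every mean rate is at
least `α`, and the tail leaves little mass above `α`, so `u_n` is rarely below `b n` for `b < α`
(`tendsto_compl_edgeGE`). A path from the middle of the left side to the right edge at the last
column then stays in the parallelogram with high probability. It cannot go too high by the upper
tail, nor too low, because it would have to climb back too fast, which the same tail forbids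
(`crossing_origin_of`). -/

/-- The σ-algebra generated by the states of the sites in `S`. -/
@[reducible] def siteSigma (S : Set Site) : MeasurableSpace Config :=
  ⨆ s ∈ S, MeasurableSpace.comap (fun ω : Config => ω s) inferInstance

lemma siteSigma_mono {S T : Set Site} (h : S ⊆ T) : siteSigma S ≤ siteSigma T :=
  biSup_mono h

lemma siteSigma_le (S : Set Site) : siteSigma S ≤ MeasurableSpace.pi := by
  refine iSup₂_le fun s _ => ?_
  exact (measurable_pi_apply s).comap_le

lemma measurableSet_open_siteSigma {S : Set Site} {s : Site} (hs : s ∈ S) :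
    MeasurableSet[siteSigma S] {ω : Config | ω s = true} := by
  have h : MeasurableSpace.comap (fun ω : Config => ω s) inferInstance ≤ siteSigma S :=
    le_iSup₂_of_le s hs le_rfl
  exact h _ ⟨{true}, trivial, by ext; simp⟩

instance isProbabilityMeasure_law (p : unitInterval) : IsProbabilityMeasure (law p) := by
  unfold law; infer_instance

lemma iIndep_sites (p : unitInterval) :
    iIndep (fun s : Site => MeasurableSpace.comap (fun ω : Config => ω s) inferInstance)
      (law p) := by
  have h : iIndepFun (fun (s : Site) (ω : Config) => ω s) (law p) :=
    iIndepFun_infinitePi (P := fun _ : Site => bernoulliMeasure true false p)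
      (X := fun _ b => b) (fun _ => measurable_id)
  exact h.iIndep

lemma indep_siteSigma (p : unitInterval) {S T : Set Site} (h : Disjoint S T) :
    Indep (siteSigma S) (siteSigma T) (law p) :=
  indep_iSup_of_disjoint (fun s => (measurable_pi_apply s).comap_le) (iIndep_sites p) h

lemma iIndepFun_of_siteSigma (p : unitInterval) {ι : Type*} {β : ι → Type*}
    [m : ∀ i, MeasurableSpace (β i)] (f : ∀ i, Config → β i) (S : ι → Set Site)
    (hf : ∀ i, Measurable[siteSigma (S i)] (f i))
    (hS : ∀ i j, i ≠ j → Disjoint (S i) (S j)) :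
    iIndepFun f (law p) := by
  classical
  rw [iIndepFun_iff]
  intro s f' H
  have H' : ∀ i ∈ s, MeasurableSet[siteSigma (S i)] (f' i) := fun i hi =>
    (hf i).comap_le _ (H i hi)
  clear H
  induction s using Finset.induction_on with
  | empty => simp
  | insert i s his ih =>
    rw [Finset.set_biInter_insert, Finset.prod_insert his,
      ← ih fun j hj => H' j (Finset.mem_insert_of_mem hj)]
    have hd : Disjoint (S i) (⋃ j ∈ s, S j) := by
      rw [Set.disjoint_iUnion₂_right]
      intro j hj
      exact hS i j fun h => his (h ▸ hj)
    refine ((Indep_iff _ _ _).1 (indep_siteSigma p hd)) _ _ (H' i (Finset.mem_insert_self i s)) ?_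
    refine @Finset.measurableSet_biInter _ _ (siteSigma _) _ s fun j hj => ?_
    exact siteSigma_mono (Set.subset_biUnion_of_mem (u := S) (Finset.mem_coe.2 hj)) _
      (H' j (Finset.mem_insert_of_mem hj))

lemma indepFun_of_siteSigma (p : unitInterval) {β γ : Type*} [MeasurableSpace β]
    [MeasurableSpace γ] {f : Config → β} {g : Config → γ} {S T : Set Site}
    (hf : Measurable[siteSigma S] f) (hg : Measurable[siteSigma T] g) (h : Disjoint S T) :
    IndepFun f g (law p) := by
  rw [IndepFun_iff_Indep]
  exact indep_of_indep_of_le_left (indep_of_indep_of_le_right (indep_siteSigma p h) hg.comap_le)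
    hf.comap_le

lemma measurableSet_reflTransGen {Ω β : Type*} [Countable β] {mΩ : MeasurableSpace Ω}
    {R : Ω → β → β → Prop} (hR : ∀ a b, MeasurableSet {ω | R ω a b}) (a b : β) :
    MeasurableSet {ω | Relation.ReflTransGen (R ω) a b} := by
  -- `T n c` is the event that `c` is reached from `a` in exactly `n` steps.
  let T : ℕ → β → Set Ω := fun n => n.rec (fun c => {_ω | a = c})
    (fun _ t c => ⋃ d, t d ∩ {ω | R ω d c})
  have hT : ∀ n c, MeasurableSet (T n c) := by
    intro n
    induction n with
    | zero => intro c; exact MeasurableSet.const _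
    | succ n ih => intro c; exact MeasurableSet.iUnion fun d => (ih d).inter (hR d c)
  have h : {ω | Relation.ReflTransGen (R ω) a b} = ⋃ n, T n b := by
    ext ω
    simp only [Set.mem_ofPred_eq, Set.mem_iUnion]
    constructor
    · intro h
      induction h with
      | refl => exact ⟨0, rfl⟩
      | tail _ hbc ih =>
        obtain ⟨n, hn⟩ := ih
        exact ⟨n + 1, Set.mem_iUnion.2 ⟨_, hn, hbc⟩⟩
    · rintro ⟨n, hn⟩
      induction n generalizing b with
      | zero => obtain rfl : a = b := hn; exact .refl
      | succ n ih =>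
        obtain ⟨d, hd, hdb⟩ := Set.mem_iUnion.1 hn
        exact (ih d hd).tail hdb
  rw [h]
  exact MeasurableSet.iUnion fun n => hT n b

lemma Step.fst_lt {ω : Config} {a b : Site} (h : Step ω a b) : a.1.1 < b.1.1 := by
  rcases h.2 with h | h | h <;> simp [h]

lemma measurableSet_step {S : Set Site} {a : Site} (ha : a ∈ S) (b : Site) :
    MeasurableSet[siteSigma S] {ω | Step ω a b} :=
  @MeasurableSet.inter _ (siteSigma S) _ _ (measurableSet_open_siteSigma ha)
    (@MeasurableSet.const _ (siteSigma S) _)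

lemma measurableSet_connIn (S : Set Site) (a b : Site) :
    MeasurableSet[siteSigma S] {ω | ConnIn ω S a b} := by
  have h : {ω | ConnIn ω S a b} = {_ω | a ∈ S} ∩
      {ω | Relation.ReflTransGen (fun x y => x ∈ S ∧ Step ω x y ∧ y ∈ S) a b} := by
    ext ω
    constructor
    · rintro ⟨ha, h⟩
      refine ⟨ha, ?_⟩
      suffices Relation.ReflTransGen (fun x y => x ∈ S ∧ Step ω x y ∧ y ∈ S) a b ∧ b ∈ S from
        this.1
      induction h with
      | refl => exact ⟨.refl, ha⟩
      | tail _ hbc ih => exact ⟨ih.1.tail ⟨ih.2, hbc⟩, hbc.2⟩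
    · rintro ⟨ha, h⟩
      exact ⟨ha, Relation.ReflTransGen.mono (fun _ _ h => h.2) _ _ h⟩
  rw [h]
  refine @MeasurableSet.inter _ (siteSigma S) _ _ (@MeasurableSet.const _ (siteSigma S) _) ?_
  refine @measurableSet_reflTransGen _ _ _ (siteSigma S) _ (fun x y => ?_) a b
  by_cases hx : x ∈ S
  · simp only [hx, true_and]
    exact @MeasurableSet.inter _ (siteSigma S) _ _ (measurableSet_step hx y)
      (@MeasurableSet.const _ (siteSigma S) _)
  · simp [hx]

/-- The sites whose first coordinate lies in `[k, l)`. -/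
def columns (k l : ℤ) : Set Site := {s | k ≤ s.1.1 ∧ s.1.1 < l}

lemma Conn.fst_le {ω : Config} {a b : Site} (h : Conn ω a b) : a.1.1 ≤ b.1.1 := by
  induction h with
  | refl => exact le_rfl
  | tail _ h ih => exact ih.trans h.fst_lt.le

/-- The half-open range of columns matters: the endpoint of a path need not be open, so what happens
before a column is independent of what starts there. -/
lemma measurableSet_conn (a b : Site) :
    MeasurableSet[siteSigma (columns a.1.1 b.1.1)] {ω | Conn ω a b} := by
  set S := columns a.1.1 b.1.1 with hS
  have h : {ω | Conn ω a b} =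
      {ω | Relation.ReflTransGen (fun x y => x ∈ S ∧ Step ω x y) a b} := by
    ext ω
    constructor
    · intro h
      change Relation.ReflTransGen _ a b
      suffices ∀ c, Conn ω a c → c.1.1 ≤ b.1.1 →
          Relation.ReflTransGen (fun x y => x ∈ S ∧ Step ω x y) a c from this b h le_rfl
      intro c hc
      induction hc with
      | refl => exact fun _ => .refl
      | tail had hdc ih =>
        intro hcb
        have h1 := hdc.fst_lt
        exact (ih (h1.le.trans hcb)).tail ⟨⟨Conn.fst_le had, h1.trans_le hcb⟩, hdc⟩
    · intro h
      exact Relation.ReflTransGen.mono (fun _ _ h => h.2) _ _ h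
  rw [h]
  refine @measurableSet_reflTransGen _ _ _ (siteSigma S) _ (fun x y => ?_) a b
  by_cases hx : x ∈ S
  · simpa only [hx, true_and] using measurableSet_step hx y
  · simp [hx]

/-! ### Symmetries of the model -/

/-- Injectivity is enough, since a subfamily of i.i.d. variables has the same law. Translations of
the half-plane are not surjective. -/
lemma measurePreserving_comp (p : unitInterval) {σ : Site → Site} (hσ : σ.Injective) :
    MeasurePreserving (fun ω : Config => fun s => ω (σ s)) (law p) (law p) where
  measurable := by fun_prop
  map_eq := by
    unfold law
    exact Measure.map_infinitePi_infinitePi_of_inj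
      (P := fun _ : Site => bernoulliMeasure true false p) hσ

/-- Translation of sites by the vector `c`. -/
def translate (c a : Site) : Site :=
  ⟨(a.1.1 + c.1.1, a.1.2 + c.1.2), add_nonneg a.2.1 c.2.1, by
    have h := a.2.2.add c.2.2
    rwa [add_add_add_comm] at h⟩

/-- Reflection of sites in the horizontal axis. -/
def mirror (a : Site) : Site :=
  ⟨(a.1.1, -a.1.2), a.2.1, by
    have h := a.2.2
    rw [Int.even_add] at h ⊢
    rwa [even_neg]⟩

lemma translate_injective (c : Site) : (translate c).Injective := by
  intro a b h
  simp only [translate, Subtype.mk.injEq, Prod.mk.injEq, add_left_inj] at h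
  exact Subtype.ext (Prod.ext h.1 h.2)

lemma mirror_injective : mirror.Injective := by
  intro a b h
  simp only [mirror, Subtype.mk.injEq, Prod.mk.injEq, neg_inj] at h
  exact Subtype.ext (Prod.ext h.1 h.2)

/-- The configuration seen from the site `c`. -/
def shift (c : Site) (ω : Config) : Config := fun a => ω (translate c a)

lemma measurePreserving_shift (p : unitInterval) (c : Site) :
    MeasurePreserving (shift c) (law p) (law p) :=
  measurePreserving_comp p (translate_injective c)

lemma step_shift_iff {c a b : Site} {ω : Config} :
    Step (shift c ω) a b ↔ Step ω (translate c a) (translate c b) := by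
  simp only [Step, shift, translate, Prod.ext_iff]
  refine and_congr_right fun _ => ?_
  constructor <;> intro h <;> omega

lemma Conn.translate {c a b : Site} {ω : Config} (h : Conn (shift c ω) a b) :
    Conn ω (translate c a) (translate c b) := by
  induction h with
  | refl => exact .refl
  | tail _ hdb ih => exact ih.tail (step_shift_iff.1 hdb)

/-- A site that is at or above the column of `c`, seen from `c`. -/
def untranslate (c a : Site) (h : c.1.1 ≤ a.1.1) : Site :=
  ⟨(a.1.1 - c.1.1, a.1.2 - c.1.2), sub_nonneg.2 h, by
    have h := a.2.2.sub c.2.2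
    rwa [add_sub_add_comm] at h⟩

@[simp] lemma translate_untranslate (c a : Site) (h : c.1.1 ≤ a.1.1) :
    translate c (untranslate c a h) = a := by
  simp [translate, untranslate]

lemma Conn.untranslate {c a b : Site} {ω : Config} (h : Conn ω a b) (ha : c.1.1 ≤ a.1.1) :
    Conn (shift c ω) (untranslate c a ha) (untranslate c b (ha.trans h.fst_le)) := by
  induction h with
  | refl => exact .refl
  | tail had hdb ih => exact ih.tail (step_shift_iff.2 (by simpa using hdb))

lemma measurable_siteSigma_shift {β : Type*} [MeasurableSpace β] {f : Config → β}
    (hf : Measurable f) (c : Site) {S : Set Site} (hS : ∀ a, translate c a ∈ S) :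
    Measurable[siteSigma S] fun ω => f (shift c ω) := by
  refine @Measurable.comp _ _ _ (siteSigma S) _ _ _ _ hf
    ((@measurable_pi_iff _ _ _ (siteSigma S) _ _).2 fun a => ?_)
  refine (@measurable_iff_comap_le _ _ (siteSigma S) _ _).2 ?_
  exact le_iSup₂_of_le (translate c a) (hS a) le_rfl

/-! ### Planarity: paths that change their order meet -/

/-- `f` is the height function of a path from `a` to `b` along the relation `R`, extended to the
columns that the path skips. -/
structure IsTrack (R : Site → Site → Prop) (a b : Site) (f : ℤ → ℤ) : Prop where
  left : f a.1.1 = a.1.2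
  right : f b.1.1 = b.1.2
  lip : ∀ n, a.1.1 ≤ n → n < b.1.1 → |f (n + 1) - f n| ≤ 1
  skip : ∀ n, a.1.1 ≤ n → n ≤ b.1.1 → (n + f n) % 2 = 1 →
    a.1.1 < n ∧ n < b.1.1 ∧ f (n - 1) = f n ∧ f (n + 1) = f n
  mem : ∀ s : Site, a.1.1 ≤ s.1.1 → s.1.1 ≤ b.1.1 → f s.1.1 = s.1.2 →
    Relation.ReflTransGen R a s ∧ Relation.ReflTransGen R s b

/-- `R` consists of steps `(1, 1)`, `(2, 0)` and `(1, -1)`. -/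
def IsStepRel (R : Site → Site → Prop) : Prop :=
  ∀ a b, R a b →
    b.1 = (a.1.1 + 1, a.1.2 + 1) ∨ b.1 = (a.1.1 + 2, a.1.2) ∨ b.1 = (a.1.1 + 1, a.1.2 - 1)

lemma site_ext {a b : Site} (h1 : a.1.1 = b.1.1) (h2 : a.1.2 = b.1.2) : a = b :=
  Subtype.ext (Prod.ext h1 h2)

lemma site_mod (a : Site) : (a.1.1 + a.1.2) % 2 = 0 := Int.even_iff.1 a.2.2

lemma exists_isTrack {R : Site → Site → Prop} (hR : IsStepRel R) {a b : Site}
    (h : Relation.ReflTransGen R a b) : a.1.1 ≤ b.1.1 ∧ ∃ f, IsTrack R a b f := by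
  induction h with
  | refl =>
    refine ⟨le_rfl, fun _ => a.1.2, rfl, rfl, fun n h1 h2 => by omega, fun n h1 h2 h3 => ?_,
      fun s h1 h2 h3 => ?_⟩
    · have := site_mod a
      obtain rfl : n = a.1.1 := by omega
      omega
    · obtain rfl : a = s := site_ext (by omega) h3
      exact ⟨.refl, .refl⟩
  | @tail b c hab hbc ih =>
    obtain ⟨hle, f, hf⟩ := ih
    have hb := site_mod b
    have hc := site_mod c
    have hstep : b.1.1 < c.1.1 ∧ c.1.1 ≤ b.1.1 + 2 ∧ |c.1.2 - b.1.2| ≤ 1 ∧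
        (c.1.1 = b.1.1 + 2 → c.1.2 = b.1.2) := by
      rcases hR b c hbc with h | h | h <;> simp [h]
    obtain ⟨h1, h2, h3, h4⟩ := hstep
    rw [abs_le] at h3
    -- A jump `(2, 0)` gives the skipped column the common height of its two ends. There `n + f n`
    -- is odd, which is how `skip` recognises it.
    refine ⟨by omega, fun n => if n ≤ b.1.1 then f n else c.1.2, ?_, ?_, ?_, ?_, ?_⟩
    · simp only [if_pos hle, hf.left]
    · simp only [if_neg (not_le.2 h1)]
    · intro n hn hn'
      have hr := hf.right
      rcases lt_trichotomy n b.1.1 with h | h | h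
      · simpa only [if_pos h.le, if_pos (show n + 1 ≤ b.1.1 by omega)] using hf.lip n hn h
      · rw [if_pos h.le, if_neg (by omega), h, abs_le]
        omega
      · rw [if_neg (by omega), if_neg (by omega)]
        simp
    · intro n hn hn' hpar
      have hr := hf.right
      by_cases h : n ≤ b.1.1
      · simp only [if_pos h] at hpar ⊢
        obtain ⟨h5, h6, h7, h8⟩ := hf.skip n hn h hpar
        rw [if_pos (by omega), if_pos (by omega)]
        exact ⟨h5, by omega, h7, h8⟩
      · simp only [if_neg h] at hpar ⊢
        have hn1 : n = b.1.1 + 1 := by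
          rcases eq_or_lt_of_le hn' with h' | h'
          · rw [h'] at hpar; omega
          · omega
        have hc1 : c.1.1 = b.1.1 + 2 := by
          by_contra hne
          have : n = c.1.1 := by omega
          rw [this] at hpar; omega
        have h9 := h4 hc1
        subst hn1
        rw [if_pos (by omega), if_neg (by omega), show b.1.1 + 1 - 1 = b.1.1 by ring]
        refine ⟨by omega, by omega, by omega, rfl⟩
    · intro s hs hs' hfs
      by_cases h : s.1.1 ≤ b.1.1
      · simp only [if_pos h] at hfs
        obtain ⟨h5, h6⟩ := hf.mem s hs h hfs
        exact ⟨h5, h6.tail hbc⟩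
      · simp only [if_neg h] at hfs
        have hsm := site_mod s
        have hsc : s.1.1 = c.1.1 := by
          by_contra hne
          have h9 : c.1.1 = b.1.1 + 2 := by omega
          have h10 : s.1.1 = b.1.1 + 1 := by omega
          have := h4 h9
          omega
        obtain rfl : s = c := site_ext hsc hfs.symm
        exact ⟨hab.tail hbc, .refl⟩

section Meet

variable {R R' : Site → Site → Prop} {a b c d : Site} {f g : ℤ → ℤ}

lemma IsTrack.exists_eq (hf : IsTrack R a b f) (hg : IsTrack R' c d g) {n₀ n₁ : ℤ}
    (h : n₀ ≤ n₁) (ha : a.1.1 ≤ n₀) (hc : c.1.1 ≤ n₀) (hb : n₁ ≤ b.1.1) (hd : n₁ ≤ d.1.1)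
    (h₀ : f n₀ ≤ g n₀) (h₁ : g n₁ ≤ f n₁) : ∃ n, n₀ ≤ n ∧ n ≤ n₁ ∧ f n = g n := by
  by_contra! hne
  have key : ∀ k : ℕ, n₀ + k ≤ n₁ → f (n₀ + k) < g (n₀ + k) := by
    intro k
    induction k with
    | zero =>
      intro _
      simpa using lt_of_le_of_ne h₀ (hne n₀ le_rfl h)
    | succ k ih =>
      intro hk
      push_cast at hk ⊢
      have hlt := ih (by omega)
      set n := n₀ + (k : ℤ) with hn
      rw [← add_assoc] at hk ⊢
      rw [← hn] at hk ⊢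
      have e := hne (n + 1) (by omega) hk
      have lf := abs_le.1 (hf.lip n (by omega) (by omega))
      have lg := abs_le.1 (hg.lip n (by omega) (by omega))
      -- Without a meeting the gap `g - f` would pass from `1` to `-1` in one step. Both tracks then
      -- move, so neither is in a skipped column, and the two heights have equal parity, against a
      -- gap of `1`.
      by_contra hcon
      have ef : f (n + 1) = f n + 1 := by omega
      have eg : g (n + 1) = g n - 1 := by omega
      have pf : ¬ (n + f n) % 2 = 1 := fun hp => by
        have := (hf.skip n (by omega) (by omega) hp).2.2.2
        omega
      have pg : ¬ (n + g n) % 2 = 1 := fun hp => by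
        have := (hg.skip n (by omega) (by omega) hp).2.2.2
        omega
      omega
  have := key (n₁ - n₀).toNat (by omega)
  rw [show n₀ + ((n₁ - n₀).toNat : ℤ) = n₁ by omega] at this
  omega

lemma IsTrack.meet (hf : IsTrack R a b f) (hg : IsTrack R' c d g) {n₀ n₁ : ℤ}
    (h : n₀ ≤ n₁) (ha : a.1.1 ≤ n₀) (hc : c.1.1 ≤ n₀) (hb : n₁ ≤ b.1.1) (hd : n₁ ≤ d.1.1)
    (h₀ : f n₀ ≤ g n₀) (h₁ : g n₁ ≤ f n₁) :
    ∃ v : Site, v.1.1 ≤ n₁ ∧ (Relation.ReflTransGen R a v ∧ Relation.ReflTransGen R v b) ∧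
      Relation.ReflTransGen R' c v ∧ Relation.ReflTransGen R' v d := by
  obtain ⟨n, hn₀, hn₁, e⟩ := hf.exists_eq hg h ha hc hb hd h₀ h₁
  have ha0 := a.2.1
  by_cases hp : (n + f n) % 2 = 1
  · obtain ⟨f1, f2, f3, -⟩ := hf.skip n (by omega) (by omega) hp
    obtain ⟨g1, g2, g3, -⟩ := hg.skip n (by omega) (by omega) (e ▸ hp)
    -- The tracks agree at a point that is not a site: both paths jump over this column, from the
    -- same site one column earlier.
    let v : Site := ⟨(n - 1, f n), by simp only; omega, by simp only [Int.even_iff]; omega⟩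
    exact ⟨v, by simp only [v]; omega,
      hf.mem v (by simp only [v]; omega) (by simp only [v]; omega) f3,
      hg.mem v (by simp only [v]; omega) (by simp only [v]; omega) (by simp only [v]; omega)⟩
  · let v : Site := ⟨(n, f n), by simp only; omega, by simp only [Int.even_iff]; omega⟩
    exact ⟨v, hn₁, hf.mem v (by simp only [v]; omega) (by simp only [v]; omega) rfl,
      hg.mem v (by simp only [v]; omega) (by simp only [v]; omega) e.symm⟩

/-- Reflection in the height `k` lets rising and falling paths be treated at once. -/
lemma IsTrack.meet_sign {σ : ℤ} (hσ : σ = 1 ∨ σ = -1) (k : ℤ)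
    (hf : IsTrack R a b f) (hg : IsTrack R' c d g) {n₀ n₁ : ℤ}
    (h : n₀ ≤ n₁) (ha : a.1.1 ≤ n₀) (hc : c.1.1 ≤ n₀) (hb : n₁ ≤ b.1.1) (hd : n₁ ≤ d.1.1)
    (h₀ : σ * (f n₀ - k) ≤ σ * (g n₀ - k)) (h₁ : σ * (g n₁ - k) ≤ σ * (f n₁ - k)) :
    ∃ v : Site, v.1.1 ≤ n₁ ∧ (Relation.ReflTransGen R a v ∧ Relation.ReflTransGen R v b) ∧
      Relation.ReflTransGen R' c v ∧ Relation.ReflTransGen R' v d := by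
  rcases hσ with rfl | rfl
  · exact hf.meet hg h ha hc hb hd (by omega) (by omega)
  · obtain ⟨v, h1, h2, h3⟩ := hg.meet hf h hc ha hd hb (by omega) (by omega)
    exact ⟨v, h1, h3, h2⟩

lemma IsTrack.exists_site (hf : IsTrack R a b f) {n : ℤ} (ha : a.1.1 ≤ n) (hb : n ≤ b.1.1)
    (hp : (n + f n) % 2 = 0) :
    ∃ s : Site, s.1.1 = n ∧ s.1.2 = f n ∧ Relation.ReflTransGen R a s := by
  have ha0 := a.2.1
  let s : Site := ⟨(n, f n), by simp only; omega, by simp only [Int.even_iff]; omega⟩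
  exact ⟨s, rfl, rfl, (hf.mem s ha hb rfl).1⟩

/-- Only skipped columns need an argument. Along a jump the height is constant, so the tilted height
decreases: the site to the left gives the upper bound and the site to the right the lower one. -/
lemma IsTrack.bounds (hf : IsTrack R a b f) {κ lo hi : ℝ} (hκ : 0 ≤ κ) {σ c k : ℤ}
    (h : ∀ s : Site, Relation.ReflTransGen R a s →
      lo ≤ σ * ((s.1.2 : ℝ) - k) - κ * ((s.1.1 : ℝ) - c) ∧
        σ * ((s.1.2 : ℝ) - k) - κ * ((s.1.1 : ℝ) - c) ≤ hi)
    {n : ℤ} (hna : a.1.1 ≤ n) (hnb : n ≤ b.1.1) :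
    lo ≤ σ * ((f n : ℝ) - k) - κ * ((n : ℝ) - c) ∧
      σ * ((f n : ℝ) - k) - κ * ((n : ℝ) - c) ≤ hi := by
  by_cases hp : (n + f n) % 2 = 1
  · obtain ⟨h1, h2, h3, h4⟩ := hf.skip n hna hnb hp
    obtain ⟨s, hs1, hs2, hs⟩ := hf.exists_site (n := n - 1) (by omega) (by omega) (by omega)
    obtain ⟨t, ht1, ht2, ht⟩ := hf.exists_site (n := n + 1) (by omega) (by omega) (by omega)
    have es := (h s hs).2
    have et := (h t ht).1
    rw [hs1, hs2, h3] at es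
    rw [ht1, ht2, h4] at et
    push_cast at es et
    constructor <;> linarith
  · obtain ⟨s, hs1, hs2, hs⟩ := hf.exists_site hna hnb (by omega)
    simpa only [hs1, hs2] using h s hs

end Meet

/-! ### Crossings of adjacent blocks -/

/-- The rising (`σ = 1`) or falling (`σ = -1`) parallelogram of the block `z`. -/
def strip (σ : ℤ) (δ α : ℝ) (L : ℕ) (z : Site) : Set Site :=
  {a | 0 ≤ relX L z a ∧ (relX L z a : ℝ) ≤ (1 + δ) * L ∧
    -(3 / 2) * δ * α * L ≤ σ * relY δ α L z a - α * relX L z a ∧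
    σ * relY δ α L z a - α * relX L z a ≤ -(1 / 2) * δ * α * L}

lemma up_eq_strip (δ α : ℝ) (L : ℕ) (z : Site) : up δ α L z = strip 1 δ α L z := by
  ext a; simp [up, strip]

lemma down_eq_strip (δ α : ℝ) (L : ℕ) (z : Site) : down δ α L z = strip (-1) δ α L z := by
  ext a; simp [down, strip]

/-- There is an open path from left to right in the parallelogram `strip σ δ α L z`. -/
def crossing (σ : ℤ) (δ α : ℝ) (L : ℕ) (z : Site) (ω : Config) : Prop :=
  ∃ a b : Site, (relX L z a = 0 ∨ relX L z a = 1) ∧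
    -(3 / 2) * δ * α * L ≤ σ * relY δ α L z a ∧ σ * relY δ α L z a ≤ -(1 / 2) * δ * α * L ∧
    relX L z b = ⌊(1 + δ) * (L : ℝ)⌋ ∧ ConnIn ω (strip σ δ α L z) a b

lemma upCrossing_iff {δ α : ℝ} {L : ℕ} {z : Site} {ω : Config} :
    upCrossing δ α L z ω ↔ crossing 1 δ α L z ω := by
  simp [upCrossing, crossing, up_eq_strip]

lemma downCrossing_iff {δ α : ℝ} {L : ℕ} {z : Site} {ω : Config} :
    downCrossing δ α L z ω ↔ crossing (-1) δ α L z ω := by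
  unfold downCrossing crossing
  rw [down_eq_strip]
  refine exists_congr fun a => exists_congr fun b => and_congr_right fun _ => ?_
  rw [← and_assoc, ← and_assoc (a := _ ≤ _)]
  refine and_congr_left fun _ => ?_
  push_cast
  constructor <;> rintro ⟨h1, h2⟩ <;> constructor <;> linarith

lemma ConnIn.mem_of_reflTransGen {ω : Config} {S : Set Site} {a b : Site} (ha : a ∈ S)
    (h : Relation.ReflTransGen (fun x y => Step ω x y ∧ y ∈ S) a b) : b ∈ S := by
  induction h with
  | refl => exact ha
  | tail _ h _ => exact h.2

lemma ConnIn.conn {ω : Config} {S : Set Site} {a b : Site} (h : ConnIn ω S a b) : Conn ω a b :=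
  Relation.ReflTransGen.mono (fun _ _ h => h.1) _ _ h.2

lemma isStepRel_connIn (ω : Config) (S : Set Site) :
    IsStepRel (fun x y => Step ω x y ∧ y ∈ S) := fun _ _ h => h.1.2

lemma mem_strip_iff {σ : ℤ} {δ α : ℝ} {L : ℕ} {z a : Site} {K : ℤ}
    (hK : (1 - δ) * α * L = K) : a ∈ strip σ δ α L z ↔
      0 ≤ relX L z a ∧ (relX L z a : ℝ) ≤ (1 + δ) * L ∧
      -(3 / 2) * (δ * α * L) ≤
        σ * ((a.1.2 : ℝ) - (K * z.1.2 : ℤ)) - α * ((a.1.1 : ℝ) - (L * z.1.1 : ℤ)) ∧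
      σ * ((a.1.2 : ℝ) - (K * z.1.2 : ℤ)) - α * ((a.1.1 : ℝ) - (L * z.1.1 : ℤ)) ≤
        -(1 / 2) * (δ * α * L) := by
  simp only [strip, relY, hK, Set.mem_ofPred_eq, relX]
  push_cast
  simp only [mul_assoc]

section Cross

variable {σ : ℤ} {δ α : ℝ} {L : ℕ} {ω : Config}

lemma floor_scale_bounds (hδ : 0 < δ) (L : ℕ) : (L : ℤ) ≤ ⌊(1 + δ) * (L : ℝ)⌋ := by
  rw [Int.le_floor]
  push_cast
  nlinarith [(Nat.cast_nonneg L : (0 : ℝ) ≤ L)]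

/-- A path in one parallelogram of a block that starts at or beyond the other parallelogram meets
the crossings of the latter. -/
lemma meet_in_block (hδ : 0 < δ) (hδ' : δ < 0.25) (hα : 0 < α) (hσ : σ = 1 ∨ σ = -1)
    (hL : Admissible δ α L) {z v q p₀ p₁ : Site}
    (h₁ : ConnIn ω (strip (-σ) δ α L z) v q) (hq : relX L z q = ⌊(1 + δ) * (L : ℝ)⌋)
    (hvL : relX L z v ≤ L)
    (hv : -(1 / 2) * (δ * α * L) ≤ σ * relY δ α L z v - α * relX L z v)
    (h₂ : ConnIn ω (strip σ δ α L z) p₀ p₁) (hp₀ : relX L z p₀ = 0 ∨ relX L z p₀ = 1)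
    (hp₀' : σ * relY δ α L z p₀ ≤ -(1 / 2) * (δ * α * L))
    (hp₁ : relX L z p₁ = ⌊(1 + δ) * (L : ℝ)⌋) :
    ∃ w, relX L z w ≤ L ∧ ConnIn ω (strip (-σ) δ α L z) v w ∧
      ConnIn ω (strip (-σ) δ α L z) w q ∧ ConnIn ω (strip σ δ α L z) w p₁ := by
  obtain ⟨hL0, -, K, -, hK⟩ := hL
  have hN := floor_scale_bounds hδ L
  have hLr : (0 : ℝ) < L := by exact_mod_cast hL0
  have hA : 0 < α * L := by positivity
  have hD : δ * α * L ≤ 0.25 * (α * L) := by rw [mul_assoc]; gcongr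
  obtain ⟨-, f, hf⟩ := exists_isTrack (isStepRel_connIn ω _) h₁.2
  obtain ⟨-, g, hg⟩ := exists_isTrack (isStepRel_connIn ω _) h₂.2
  have bf : ∀ n, v.1.1 ≤ n → n ≤ q.1.1 → _ := fun n h h' =>
    hf.bounds hα.le (fun s hs => ((mem_strip_iff hK).1 (ConnIn.mem_of_reflTransGen h₁.1 hs)).2.2) h h'
  have bg : ∀ n, p₀.1.1 ≤ n → n ≤ p₁.1.1 → _ := fun n h h' =>
    hg.bounds hα.le (fun s hs => ((mem_strip_iff hK).1 (ConnIn.mem_of_reflTransGen h₂.1 hs)).2.2) h h'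
  have hv0 := h₁.1.1
  unfold relX relY at *
  rw [hK] at hv hp₀'
  set c := (L : ℤ) * z.1.1 with hc
  have hkz : (K : ℝ) * z.1.2 = ((K * z.1.2 : ℤ) : ℝ) := by push_cast; ring
  rw [hkz] at hv hp₀'
  set k := K * z.1.2 with hk
  push_cast at hv bf bg
  have meet : ∀ n₀, n₀ ≤ c + L → p₀.1.1 ≤ n₀ → v.1.1 ≤ n₀ → σ * (g n₀ - k) ≤ σ * (f n₀ - k) →
      ∃ w, w.1.1 - c ≤ L ∧ ConnIn ω (strip (-σ) δ α L z) v w ∧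
      ConnIn ω (strip (-σ) δ α L z) w q ∧ ConnIn ω (strip σ δ α L z) w p₁ := by
    intro n₀ hn hp hv1 hle
    -- At relative column `L` the crossing of `strip σ` has signed height at least `αL - (3/2)δαL`
    -- and the other path at most the negative of this, so the order is reversed.
    have h1 : σ * (f (c + L) - k) ≤ σ * (g (c + L) - k) := by
      have e1 := (bf (c + L) (by omega) (by omega)).1
      have e2 := (bg (c + L) (by omega) (by omega)).1
      push_cast at e1 e2
      have : (σ : ℝ) * (f (c + L) - k) ≤ σ * (g (c + L) - k) := by linarith
      exact_mod_cast this
    obtain ⟨w, hw, ⟨w1, w2⟩, w3, w4⟩ := hg.meet_sign hσ k hf hn hp hv1 (by omega) (by omega) hle h1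
    exact ⟨w, by omega, ⟨h₁.1, w3⟩, ⟨ConnIn.mem_of_reflTransGen h₁.1 w3, w4⟩,
      ⟨ConnIn.mem_of_reflTransGen h₂.1 w1, w2⟩⟩
  by_cases hpv : p₀.1.1 ≤ v.1.1
  · refine meet v.1.1 (by omega) hpv le_rfl ?_
    have e1 := (bg v.1.1 hpv (by omega)).2
    rw [hf.left]
    have : (σ : ℝ) * (g v.1.1 - k) ≤ σ * (v.1.2 - k) := by linarith
    exact_mod_cast this
  -- The crossing starts one column to the right of `v`. Heights in adjacent columns differ in
  -- parity, so `p₀` is strictly beyond `v`, and one step of the track of `v` cannot overtake it.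
  · have hvc : v.1.1 = c := by omega
    have hpc : p₀.1.1 = c + 1 := by omega
    refine meet p₀.1.1 (by omega) le_rfl (by omega) ?_
    rw [hg.left]
    have e1 : σ * (p₀.1.2 - k) ≤ σ * (v.1.2 - k) := by
      have : (σ : ℝ) * (p₀.1.2 - k) ≤ σ * (v.1.2 - k) := by
        rw [hvc] at hv; simp only [sub_self, mul_zero, sub_zero] at hv; linarith
      exact_mod_cast this
    have s1 := site_mod v
    have s2 := site_mod p₀
    have hl := abs_le.1 (hf.lip v.1.1 le_rfl (by omega))
    rw [hf.left] at hl
    rw [show p₀.1.1 = v.1.1 + 1 by omega]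
    rcases hσ with rfl | rfl <;> omega

/-- Crossings of adjacent blocks meet. -/
lemma meet_next_block (hδ : 0 < δ) (hδ' : δ < 0.25) (hα : 0 < α) (hα' : α ≤ 1)
    (hσ : σ = 1 ∨ σ = -1) (hL : Admissible δ α L) {z z' s b q₀ q₁ : Site}
    (hz₁ : z'.1.1 = z.1.1 + 1) (hz₂ : z'.1.2 = z.1.2 + σ)
    (h₁ : ConnIn ω (strip σ δ α L z) s b) (hs : relX L z s ≤ L)
    (hb : relX L z b = ⌊(1 + δ) * (L : ℝ)⌋)
    (h₂ : ConnIn ω (strip (-σ) δ α L z') q₀ q₁) (hq₀ : relX L z' q₀ = 0 ∨ relX L z' q₀ = 1)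
    (hq₀' : (1 / 2) * (δ * α * L) ≤ σ * relY δ α L z' q₀)
    (hq₁ : relX L z' q₁ = ⌊(1 + δ) * (L : ℝ)⌋) :
    ∃ v, v ∈ strip σ δ α L z ∧ relX L z' v ≤ L ∧ ConnIn ω (strip σ δ α L z) s v ∧
      ConnIn ω (strip (-σ) δ α L z') v q₁ := by
  obtain ⟨hL0, -, K, -, hK⟩ := hL
  have hN := floor_scale_bounds hδ L
  have hLr : (0 : ℝ) < L := by exact_mod_cast hL0
  have hD0 : 0 < δ * α * L := by positivity
  have hN1 := Int.floor_le ((1 + δ) * (L : ℝ))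
  have hN2 := Int.lt_floor_add_one ((1 + δ) * (L : ℝ))
  set N := ⌊(1 + δ) * (L : ℝ)⌋ with hNdef
  have hNL : N < 2 * L := by
    have : (N : ℝ) < 2 * L := by nlinarith
    exact_mod_cast this
  have hσ2 : (σ : ℝ) * σ = 1 := by rcases hσ with rfl | rfl <;> norm_num
  obtain ⟨-, f, hf⟩ := exists_isTrack (isStepRel_connIn ω _) h₁.2
  obtain ⟨-, g, hg⟩ := exists_isTrack (isStepRel_connIn ω _) h₂.2
  have bf : ∀ n, s.1.1 ≤ n → n ≤ b.1.1 → _ := fun n h h' =>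
    hf.bounds hα.le (fun s hs => ((mem_strip_iff hK).1 (ConnIn.mem_of_reflTransGen h₁.1 hs)).2.2) h h'
  have bg : ∀ n, q₀.1.1 ≤ n → n ≤ q₁.1.1 → _ := fun n h h' =>
    hg.bounds hα.le (fun s hs => ((mem_strip_iff hK).1 (ConnIn.mem_of_reflTransGen h₂.1 hs)).2.2) h h'
  have hq₀s := (mem_strip_iff hK).1 h₂.1
  unfold relX at *
  unfold relY at hq₀'
  rw [hK] at hq₀'
  set c := (L : ℤ) * z'.1.1 with hc
  have hcz : (L : ℤ) * z.1.1 = c - L := by rw [hc, hz₁]; ring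
  have hkz : (K : ℝ) * z'.1.2 = ((K * z'.1.2 : ℤ) : ℝ) := by push_cast; ring
  rw [hkz] at hq₀'
  set k := K * z'.1.2 with hk
  have hkz' : K * z.1.2 = k - σ * K := by rw [hk, hz₂]; ring
  -- heights of the first path relative to the second block
  have bf' : ∀ n, s.1.1 ≤ n → n ≤ b.1.1 →
      -(1 / 2) * (δ * α * L) ≤ σ * ((f n : ℝ) - k) - α * (n - c) ∧
        σ * ((f n : ℝ) - k) - α * (n - c) ≤ (1 / 2) * (δ * α * L) := by
    intro n h h'
    have e := bf n h h'
    rw [hcz, hkz'] at e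
    push_cast at e
    rw [← hK] at e
    have e3 : (σ : ℝ) * (f n - (k - σ * ((1 - δ) * α * L))) - α * (n - (c - L)) =
        σ * ((f n : ℝ) - k) - α * (n - c) + (σ * σ * ((1 - δ) * α * L) - α * L) := by ring
    rw [e3, hσ2] at e
    constructor <;> nlinarith [e.1, e.2]
  clear bf
  rw [hcz] at hs hb
  push_cast at bg hq₀s
  have hN2' : (α : ℝ) * (δ * L) < α * ((N : ℝ) + 1 - L) := by gcongr; linarith
  have hN1' : (α : ℝ) * ((N : ℝ) - L) ≤ α * (δ * L) := by gcongr; linarith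
  -- Failure would mean `N = L`, hence `δL < 1`, with `q₀` in column `c + 1`. The signed height of
  -- `q₀` is then a positive integer, yet its strip keeps it below `α/2`.
  have hn₀ : q₀.1.1 ≤ b.1.1 := by
    by_contra hcon
    have hNL' : N = L := by omega
    have hq1 : q₀.1.1 = c + 1 := by omega
    have h3 := hq₀s.2.2.1
    rw [hNL'] at hN2'
    rw [hq1] at h3
    push_cast at h3 hN2'
    have h5 : 0 < σ * (q₀.1.2 - k) := by
      have : (0 : ℝ) < σ * (q₀.1.2 - k) := by linarith
      exact_mod_cast this
    have h6 : (1 : ℝ) ≤ σ * (q₀.1.2 - k) := by exact_mod_cast h5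
    linarith
  -- At column `c` the two bands touch at signed height `(1/2)δαL`. A start in column `c + 1` is
  -- handled by parity.
  have h0 : σ * (f q₀.1.1 - k) ≤ σ * (g q₀.1.1 - k) := by
    rw [hg.left]
    have e0 := (bf' c (by omega) (by omega)).2
    have e1 : σ * (f c - k) ≤ σ * (q₀.1.2 - k) := by
      have : (σ : ℝ) * (f c - k) ≤ σ * (q₀.1.2 - k) := by
        simp only [sub_self, mul_zero, sub_zero] at e0; linarith
      exact_mod_cast this
    rcases hq₀ with h | h
    · rwa [show q₀.1.1 = c by omega]
    · rw [show q₀.1.1 = c + 1 by omega]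
      have s2 := site_mod q₀
      have hl := abs_le.1 (hf.lip c (by omega) (by omega))
      by_cases hp : (c + f c) % 2 = 1
      · rw [(hf.skip c (by omega) (by omega) hp).2.2.2]
        exact e1
      · rcases hσ with rfl | rfl <;> omega
  -- At relative column `δL` the bands touch again, with the order reversed; this is why blocks have
  -- length `(1 + δ)L`. Rounding down to `N` costs less than `2α ≤ 2`, which parity absorbs. If the
  -- second path jumps over this column, its next column leaves an error below `1`.
  have h1 : σ * (g b.1.1 - k) ≤ σ * (f b.1.1 - k) := by
    have hbN : b.1.1 = c + N - L := by omega
    have e0 := (bf' b.1.1 (by omega) le_rfl).1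
    have s2 := site_mod b
    rw [hf.right] at e0 ⊢
    have hbr : (b.1.1 : ℝ) - c = N - L := by
      rw [hbN]; push_cast; ring
    rw [hbr] at e0
    by_cases hp : (b.1.1 + g b.1.1) % 2 = 1
    · obtain ⟨g1, g2, g3, g4⟩ := hg.skip b.1.1 hn₀ (by omega) hp
      have e2 := (bg (b.1.1 + 1) (by omega) (by omega)).1
      rw [g4] at e2
      push_cast at e2
      have e3 : (σ : ℝ) * (g b.1.1 - k) - σ * (b.1.2 - k) < 1 := by
        rw [show (b.1.1 : ℝ) + 1 - c = N - L + 1 by linarith] at e2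
        linarith
      have e4 : σ * (g b.1.1 - k) - σ * (b.1.2 - k) < 1 := by exact_mod_cast e3
      omega
    · have e2 := (bg b.1.1 hn₀ (by omega)).1
      rw [hbr] at e2
      have e3 : (σ : ℝ) * (g b.1.1 - k) - σ * (b.1.2 - k) < 2 := by linarith
      have e4 : σ * (g b.1.1 - k) - σ * (b.1.2 - k) < 2 := by exact_mod_cast e3
      rcases hσ with rfl | rfl <;> omega
  obtain ⟨w, hw, ⟨w1, -⟩, w3, w4⟩ := hf.meet_sign hσ k hg hn₀ (by omega) le_rfl le_rfl
    (by omega) h0 h1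
  exact ⟨w, ConnIn.mem_of_reflTransGen h₁.1 w1, by omega, ⟨h₁.1, w1⟩,
    ⟨ConnIn.mem_of_reflTransGen h₂.1 w3, w4⟩⟩

end Cross

/-! ### Dependence between blocks -/

section Dependence

variable {δ α : ℝ} {L : ℕ}

lemma abs_relY_le_of_mem {z a : Site} (ha : a ∈ up δ α L z ∪ down δ α L z) (hα : 0 < α)
    (hδ : 0 < δ) {t : ℝ} (ht : δ * L ≤ t) (hX : (relX L z a : ℝ) ≤ t) :
    |relY δ α L z a| ≤ α * t + (1 / 2) * (δ * α * L) := by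
  have e1 : α * (relX L z a : ℝ) ≤ α * t := by gcongr
  have e2 : α * (δ * L) ≤ α * t := by gcongr
  have h0 : (0 : ℝ) ≤ L := Nat.cast_nonneg L
  have hD : 0 ≤ δ * α * L := by positivity
  rw [abs_le]
  rcases ha with ⟨h1, -, h3, h4⟩ | ⟨h1, -, h3, h4⟩
  all_goals
    have e3 : 0 ≤ α * (relX L z a : ℝ) := mul_nonneg hα.le (by exact_mod_cast h1)
    constructor <;> linarith

/-- In units of `αL` a block has vertical extent `1 + 3δ/2` about its base point. In the same column
the row difference is even and at least `4`, and `4(1 - δ) > 2 + 3δ`. In adjacent columns it is odd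
and at least `3`; only relative columns up to `δL` of the right block overlap, with extent `3δ/2`,
and `3(1 - δ) > 1 + 3δ`. Blocks two or more columns apart share no column, as `(1 + δ)L < 2L`. -/
lemma disjoint_blocks_of_fst_le (hδ : 0 < δ) (hδ' : δ < 0.25) (hα : 0 < α)
    (hL : Admissible δ α L) {z z' : Site} (hne : z ≠ z') (hadj : ¬ blockGraph.Adj z z')
    (hle : z.1.1 ≤ z'.1.1) :
    Disjoint (up δ α L z ∪ down δ α L z) (up δ α L z' ∪ down δ α L z') := by
  rw [Set.disjoint_left]
  intro a ha ha'
  have hLr : (0 : ℝ) < L := by exact_mod_cast hL.1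
  have hD0 : 0 < δ * α * L := by positivity
  have hA : 0 < α * L := by positivity
  have hD : δ * α * L ≤ 0.25 * (α * L) := by rw [mul_assoc]; gcongr
  have hX : (relX L z a : ℝ) ≤ (1 + δ) * L := by rcases ha with h | h <;> exact h.2.1
  have hX' : (0 : ℝ) ≤ relX L z' a := by
    rcases ha' with h | h <;> exact_mod_cast h.1
  have hXX : (relX L z a : ℝ) = relX L z' a + L * (z'.1.1 - z.1.1) := by
    simp only [relX]; push_cast; ring
  have hYY : relY δ α L z a - relY δ α L z' a = (α * L - δ * α * L) * (z'.1.2 - z.1.2) := by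
    simp only [relY]; ring
  have b1 := abs_le.1 (abs_relY_le_of_mem ha hα hδ (by linarith) hX)
  have key : ∀ M : ℤ, 0 ≤ M → M ≤ |z'.1.2 - z.1.2| →
      |relY δ α L z' a| < (α * L - δ * α * L) * M - (α * ((1 + δ) * L) + 1 / 2 * (δ * α * L)) →
      False := by
    intro M hM hMz hY
    have b2 := abs_lt.1 hY
    rcases le_abs.1 hMz with h | h
    · have h' : (M : ℝ) ≤ z'.1.2 - z.1.2 := by exact_mod_cast h
      have := mul_le_mul_of_nonneg_left h' (show 0 ≤ α * L - δ * α * L by linarith)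
      linarith
    · have h' : (M : ℝ) ≤ z.1.2 - z'.1.2 := by push_cast [← Int.cast_sub]; exact_mod_cast (by omega)
      have := mul_le_mul_of_nonneg_left h' (show 0 ≤ α * L - δ * α * L by linarith)
      linarith
  have s1 := site_mod z
  have s2 := site_mod z'
  have hadj' : ¬ ((|z.1.1 - z'.1.1| = 1 ∧ |z.1.2 - z'.1.2| = 1) ∨
    (z.1.1 = z'.1.1 ∧ |z.1.2 - z'.1.2| = 2)) := hadj
  simp only [abs_eq (zero_le_one' ℤ), abs_eq (zero_le_two (α := ℤ))] at hadj'
  obtain h | h | h : z'.1.1 = z.1.1 ∨ z'.1.1 = z.1.1 + 1 ∨ z.1.1 + 2 ≤ z'.1.1 := by omega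
  · have hy : z.1.2 ≠ z'.1.2 := fun hy => hne (site_ext h.symm hy)
    refine key 4 (by norm_num) (le_abs.2 (by omega)) ?_
    have hX2 : (relX L z' a : ℝ) ≤ (1 + δ) * L := by
      rcases ha' with h | h <;> exact h.2.1
    have := abs_relY_le_of_mem ha' hα hδ (by linarith) hX2
    push_cast
    linarith
  · refine key 3 (by norm_num) (le_abs.2 (by omega)) ?_
    have hX2 : (relX L z' a : ℝ) ≤ δ * L := by
      rw [h] at hXX; push_cast at hXX; linarith
    have := abs_relY_le_of_mem ha' hα hδ le_rfl hX2
    push_cast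
    linarith
  · have h' : (2 : ℝ) ≤ z'.1.1 - z.1.1 := by
      have : (z.1.1 : ℝ) + 2 ≤ z'.1.1 := by exact_mod_cast h
      linarith
    have := mul_le_mul_of_nonneg_left h' hLr.le
    nlinarith

lemma disjoint_blocks (hδ : 0 < δ) (hδ' : δ < 0.25) (hα : 0 < α)
    (hL : Admissible δ α L) {z z' : Site} (hne : z ≠ z') (hadj : ¬ blockGraph.Adj z z') :
    Disjoint (up δ α L z ∪ down δ α L z) (up δ α L z' ∪ down δ α L z') := by
  rcases le_total z.1.1 z'.1.1 with h | h
  · exact disjoint_blocks_of_fst_le hδ hδ' hα hL hne hadj h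
  · exact (disjoint_blocks_of_fst_le hδ hδ' hα hL hne.symm (fun h => hadj h.symm) h).symm

lemma measurableSet_crossing (σ : ℤ) (δ α : ℝ) (L : ℕ) (z : Site) :
    MeasurableSet[siteSigma (strip σ δ α L z)] {ω | crossing σ δ α L z ω} := by
  simp only [crossing, Set.ofPred_exists]
  refine @MeasurableSet.iUnion _ _ (siteSigma _) _ _ fun a =>
    @MeasurableSet.iUnion _ _ (siteSigma _) _ _ fun b => ?_
  simp only [Set.ofPred_and]
  refine @MeasurableSet.inter _ (siteSigma _) _ _ (@MeasurableSet.const _ (siteSigma _) _) ?_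
  refine @MeasurableSet.inter _ (siteSigma _) _ _ (@MeasurableSet.const _ (siteSigma _) _) ?_
  refine @MeasurableSet.inter _ (siteSigma _) _ _ (@MeasurableSet.const _ (siteSigma _) _) ?_
  exact @MeasurableSet.inter _ (siteSigma _) _ _ (@MeasurableSet.const _ (siteSigma _) _)
    (measurableSet_connIn _ a b)

lemma goodBlock_eq (δ α : ℝ) (L : ℕ) (z : Site) :
    goodBlock δ α L z = {ω | crossing 1 δ α L z ω} ∩ {ω | crossing (-1) δ α L z ω} := by
  ext ω
  simp only [goodBlock, upCrossing_iff, downCrossing_iff]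
  rfl

lemma measurableSet_goodBlock (δ α : ℝ) (L : ℕ) (z : Site) :
    MeasurableSet[siteSigma (up δ α L z ∪ down δ α L z)] (goodBlock δ α L z) := by
  rw [goodBlock_eq, up_eq_strip, down_eq_strip]
  exact @MeasurableSet.inter _ (siteSigma _) _ _
    (siteSigma_mono Set.subset_union_left _ (measurableSet_crossing 1 δ α L z))
    (siteSigma_mono Set.subset_union_right _ (measurableSet_crossing (-1) δ α L z))

lemma measurable_eta (δ α : ℝ) (L : ℕ) (z : Site) :
    Measurable[siteSigma (up δ α L z ∪ down δ α L z)] (eta δ α L z) := by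
  change Measurable[siteSigma (up δ α L z ∪ down δ α L z)]
    ((goodBlock δ α L z).indicator fun _ => 1)
  let _ : MeasurableSpace Config := siteSigma (up δ α L z ∪ down δ α L z)
  exact Measurable.indicator measurable_const (measurableSet_goodBlock δ α L z)

lemma iIndepFun_eta (p : unitInterval) (hδ : 0 < δ) (hδ' : δ < 0.25) (hα : 0 < α)
    (hL : Admissible δ α L) {m : ℕ} (z : Fin m → Site)
    (hz : ∀ i j : Fin m, i ≠ j → 1 < blockGraph.edist (z i) (z j)) :
    iIndepFun (fun i => eta δ α L (z i)) (law p) := by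
  refine iIndepFun_of_siteSigma p _ (fun i => up δ α L (z i) ∪ down δ α L (z i))
    (fun i => measurable_eta δ α L (z i)) fun i j hij => ?_
  have h := hz i j hij
  refine disjoint_blocks hδ hδ' hα hL (fun e => ?_) fun hadj => ?_
  · simp [e] at h
  · rw [SimpleGraph.edist_eq_one_iff_adj.2 hadj] at h
    exact lt_irrefl _ h

/-- The whole family of non-neighbours is measurable with respect to the complement of the
parallelograms of `z`, although its members may depend on each other. -/
lemma indepFun_eta (p : unitInterval) (hδ : 0 < δ) (hδ' : δ < 0.25) (hα : 0 < α)
    (hL : Admissible δ α L) (z : Site) :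
    IndepFun (eta δ α L z)
      (fun (ω : Config) (z' : {z' : Site // z' ≠ z ∧ z' ∉ blockGraph.neighborSet z}) =>
        eta δ α L z'.1 ω) (law p) := by
  refine indepFun_of_siteSigma p (measurable_eta δ α L z)
    (T := (up δ α L z ∪ down δ α L z)ᶜ) ?_ disjoint_compl_right
  refine (@measurable_pi_iff _ _ _ (siteSigma _) _ _).2 fun z' => ?_
  refine (measurable_eta δ α L z'.1).mono (siteSigma_mono ?_) le_rfl
  exact Set.subset_compl_iff_disjoint_left.2
    (disjoint_blocks hδ hδ' hα hL z'.2.1.symm fun h => z'.2.2 h)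

lemma encard_neighborSet_le (z : Site) : (blockGraph.neighborSet z).encard ≤ 6 := by
  rw [← (Subtype.val_injective.injOn (s := blockGraph.neighborSet z)).encard_image]
  have hsub : Subtype.val '' blockGraph.neighborSet z ⊆
      (({(z.1.1 + 1, z.1.2 + 1), (z.1.1 + 1, z.1.2 - 1), (z.1.1 - 1, z.1.2 + 1),
        (z.1.1 - 1, z.1.2 - 1), (z.1.1, z.1.2 + 2), (z.1.1, z.1.2 - 2)} : Finset (ℤ × ℤ)) :
        Set (ℤ × ℤ)) := by
    rintro _ ⟨a, ha, rfl⟩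
    have ha' : (|z.1.1 - a.1.1| = 1 ∧ |z.1.2 - a.1.2| = 1) ∨
      (z.1.1 = a.1.1 ∧ |z.1.2 - a.1.2| = 2) := ha
    simp only [abs_eq (zero_le_one' ℤ), abs_eq (zero_le_two (α := ℤ))] at ha'
    simp only [Finset.coe_insert, Finset.coe_singleton, Set.mem_insert_iff,
      Set.mem_singleton_iff, Prod.ext_iff]
    omega
  refine (Set.encard_le_encard hsub).trans ?_
  rw [Set.encard_coe_eq_coe_finsetCard]
  exact_mod_cast Finset.card_le_six

end Dependence

/-! ### Percolation of the block system -/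

section Percolation

variable {δ α : ℝ} {L : ℕ} {ω : Config}

lemma eta_eq_one_iff {z : Site} :
    eta δ α L z ω = 1 ↔ crossing 1 δ α L z ω ∧ crossing (-1) δ α L z ω := by
  rw [← upCrossing_iff, ← downCrossing_iff]
  by_cases h : ω ∈ goodBlock δ α L z
  · simp only [eta, Set.indicator_of_mem h, true_iff]
    exact h
  · simp only [eta, Set.indicator_of_notMem h, zero_ne_one, false_iff]
    exact h

/-- The site `a` is connected to a path in the parallelogram `strip σ δ α L z` that starts no later
than the left side of the next blocks and ends at the right side. -/
def Feeds (σ : ℤ) (δ α : ℝ) (L : ℕ) (ω : Config) (a z : Site) : Prop :=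
  ∃ s b, relX L z s ≤ L ∧ Conn ω a s ∧ ConnIn ω (strip σ δ α L z) s b ∧
    relX L z b = ⌊(1 + δ) * (L : ℝ)⌋

lemma exists_feeds_origin (hδ : 0 < δ) (hδ' : δ < 0.25) (hα : 0 < α) (hα' : α ≤ 1)
    (hL : Admissible δ α L) (h : eta δ α L origin ω = 1) :
    ∃ a : Site, (a.1.1 = 0 ∨ a.1.1 = 1) ∧
      -(3 / 2) * δ * α * L ≤ (a.1.2 : ℝ) ∧ (a.1.2 : ℝ) ≤ -(1 / 2) * δ * α * L ∧
      Feeds 1 δ α L ω a origin ∧ Feeds (-1) δ α L ω a origin := by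
  have hLr : (0 : ℝ) < L := by exact_mod_cast hL.1
  have hD0 : 0 < δ * α * L := by positivity
  obtain ⟨⟨a, b, ha1, ha2, ha3, hb, hab⟩, ⟨c, d, hc1, hc2, hc3, hd, hcd⟩⟩ := eta_eq_one_iff.1 h
  have hX : ∀ s, relX L origin s = s.1.1 := fun s => by simp [relX, origin]
  have hY : ∀ s, relY δ α L origin s = s.1.2 := fun s => by simp [relY, origin]
  have hL1 : (1 : ℤ) ≤ L := by exact_mod_cast hL.1
  obtain ⟨w, hw, w1, w2, w3⟩ := meet_in_block (σ := -1) hδ hδ' hα (Or.inr rfl) hL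
    (by simpa using hab) hb (by omega) (by
      rw [hY] at ha3 ⊢
      rw [hX] at ha1 ⊢
      -- If `a` lies in column `1`, its height must still exceed in size the term `α ≤ 1`; being a
      -- negative integer it is at most `-1`.
      have h1 : a.1.2 < 0 := by
        have : (a.1.2 : ℝ) < 0 := by push_cast at ha3; linarith
        exact_mod_cast this
      have h2 : (a.1.2 : ℝ) ≤ -1 := by exact_mod_cast Int.le_sub_one_of_lt h1
      have h3 : α * (a.1.1 : ℝ) ≤ 1 := by
        rcases ha1 with h | h <;> rw [h] <;> push_cast <;> linarith
      push_cast
      linarith) hcd hc1 (by linarith) hd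
  refine ⟨a, by simpa [hX] using ha1, by simpa [hY] using ha2, by simpa [hY] using ha3,
    ⟨a, b, by omega, .refl, hab, hb⟩, ⟨w, d, hw, w1.conn, w3, hd⟩⟩

/-- The arriving path meets the `-σ` crossing of the new block at `v`. Seen from that block, `v` is
on or beyond the outer side of `strip σ`, so following the `-σ` crossing from `v` leads to the `σ`
crossing as well. -/
lemma Feeds.next (hδ : 0 < δ) (hδ' : δ < 0.25) (hα : 0 < α) (hα' : α ≤ 1)
    (hL : Admissible δ α L) {σ : ℤ} (hσ : σ = 1 ∨ σ = -1) {a z z' : Site}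
    (hz₁ : z'.1.1 = z.1.1 + 1) (hz₂ : z'.1.2 = z.1.2 + σ) (h : Feeds σ δ α L ω a z)
    (h₁ : crossing σ δ α L z' ω) (h₂ : crossing (-σ) δ α L z' ω) :
    Feeds σ δ α L ω a z' ∧ Feeds (-σ) δ α L ω a z' := by
  obtain ⟨s, b, hs, has, hsb, hb⟩ := h
  obtain ⟨p₀, p₁, hp1, hp2, hp3, hp4, hp⟩ := h₁
  obtain ⟨q₀, q₁, hq1, hq2, hq3, hq4, hq⟩ := h₂
  push_cast at hq2 hq3
  obtain ⟨v, hv1, hv2, hv3, hv4⟩ := meet_next_block hδ hδ' hα hα' hσ hL hz₁ hz₂ hsb hs hb hq hq1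
    (by linarith) hq4
  have hv5 := hv1.2.2.1
  have hσ2 : (σ : ℝ) * σ = 1 := by rcases hσ with rfl | rfl <;> norm_num
  have hY : (σ : ℝ) * relY δ α L z v = σ * relY δ α L z' v + (1 - δ) * α * L := by
    simp only [relY, hz₂]; push_cast
    linear_combination ((1 - δ) * α * L) * hσ2
  have hX : (relX L z v : ℝ) = relX L z' v + L := by
    simp only [relX, hz₁]; push_cast; ring
  rw [hY, hX] at hv5
  obtain ⟨w, hw, w1, w2, w3⟩ := meet_in_block hδ hδ' hα hσ hL hv4 hq4 hv2 (by linarith) hp hp1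
    (by linarith) hp4
  exact ⟨⟨w, p₁, hw, has.trans (hv3.conn.trans w1.conn), w3, hp4⟩,
    ⟨v, q₁, hv2, has.trans hv3.conn, hv4, hq4⟩⟩

lemma finite_cone (B : ℤ) : {b : Site | b.1.1 ≤ B ∧ |b.1.2| ≤ b.1.1}.Finite := by
  refine Set.Finite.of_finite_image (f := Subtype.val) ?_ Subtype.val_injective.injOn
  refine (Set.finite_Icc ((0 : ℤ), -B) (B, B)).subset ?_
  rintro _ ⟨b, ⟨h1, h2⟩, rfl⟩
  have := b.2.1
  rw [abs_le] at h2
  simp only [Set.mem_Icc, Prod.le_def]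
  omega

lemma exists_infinite_cluster (hδ : 0 < δ) (hδ' : δ < 0.25) (hα : 0 < α) (hα' : α ≤ 1)
    (hL : Admissible δ α L) (hinf : (etaCluster δ α L ω).Infinite) :
    ∃ a : Site, (a.1.1 = 0 ∨ a.1.1 = 1) ∧
      -(3 / 2) * δ * α * L ≤ (a.1.2 : ℝ) ∧ (a.1.2 : ℝ) ≤ -(1 / 2) * δ * α * L ∧
      (cluster ω a).Infinite := by
  have ho : eta δ α L origin ω = 1 := by
    obtain ⟨b, hb, hbo⟩ := hinf.exists_notMem_finite (Set.finite_singleton origin)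
    rcases Relation.ReflTransGen.cases_head hb with h | ⟨c, hc, -⟩
    · exact absurd h.symm hbo
    · exact hc.1
  obtain ⟨a, ha1, ha2, ha3, hf1, hf2⟩ := exists_feeds_origin hδ hδ' hα hα' hL ho
  refine ⟨a, ha1, ha2, ha3, fun hfin => ?_⟩
  have hfeed : ∀ b ∈ etaCluster δ α L ω, eta δ α L b ω = 1 →
      Feeds 1 δ α L ω a b ∧ Feeds (-1) δ α L ω a b := by
    intro b hb
    induction hb with
    | refl => exact fun _ => ⟨hf1, hf2⟩
    | tail _ hcd ih =>
      intro hd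
      obtain ⟨h1, h2⟩ := ih hcd.1
      obtain ⟨h3, h4⟩ := eta_eq_one_iff.1 hd
      rcases hcd.2 with e | e
      · exact Feeds.next hδ hδ' hα hα' hL (Or.inl rfl) (by rw [e]) (by rw [e]) h1 h3 h4
      · exact (Feeds.next hδ hδ' hα hα' hL (Or.inr rfl) (by rw [e]) (by rw [e]; rfl) h2 h4
          (by simpa using h3)).symm
  obtain ⟨B, hB⟩ := (hfin.image fun b : Site => b.1.1).bddAbove
  have hBa : ∀ b, Conn ω a b → b.1.1 ≤ B := fun b hb => hB ⟨b, hb, rfl⟩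
  have hN := floor_scale_bounds hδ L
  have hL1 : (1 : ℤ) ≤ L := by exact_mod_cast hL.1
  have hB0 : 0 ≤ B := a.2.1.trans (hBa a .refl)
  -- Every block with a successor is good and fed, so the cluster of `a` reaches its last column. A
  -- bound on those columns bounds the block columns, and the block cluster lies in a cone.
  refine hinf ((finite_cone (B + 1)).subset fun b hb => ?_)
  have hcone : |b.1.2| ≤ b.1.1 := by
    induction hb with
    | refl => simp [origin]
    | tail _ hcd ih =>
      rw [abs_le] at ih ⊢
      rcases hcd.2 with e | e <;> rw [e] <;> simp only <;> omega
  refine ⟨?_, hcone⟩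
  rcases Relation.ReflTransGen.cases_tail hb with h | ⟨c, hc, hcb⟩
  · rw [h]; simp only [origin]; omega
  · obtain ⟨s, d, -, has, hsd, hd⟩ := (hfeed c hc hcb.1).1
    have h1 := hBa d (has.trans hsd.conn)
    have h2 := c.2.1
    have h3 : c.1.1 ≤ L * c.1.1 := le_mul_of_one_le_left h2 hL1
    unfold relX at hd
    rcases hcb.2 with e | e <;> rw [e] <;> simp only <;> omega

end Percolation

/-! ### Exponential moments of the right edge -/

lemma Conn.snd_sub_le {ω : Config} {a b : Site} (h : Conn ω a b) :
    b.1.2 - a.1.2 ≤ b.1.1 - a.1.1 := by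
  induction h with
  | refl => simp
  | tail _ h ih => rcases h.2 with e | e | e <;> rw [e] <;> simp only <;> omega

lemma le_of_mem_xiBar {ω : Config} {n : ℕ} {x : ℤ} (hx : x ∈ xiBar ω n) : x ≤ n := by
  obtain ⟨a, b, ha, ha', hb, hab⟩ := hx
  have h := hab.snd_sub_le
  rw [hb] at h
  simp only at h
  have := a.2.1
  omega

/-- A path that crosses the column `m` either visits it or jumps over it, and in the latter case
its site before the jump is connected to a site of the column just above the jump. -/
lemma Conn.cut {ω : Config} {a b : Site} (h : Conn ω a b) {m : ℤ} (ha : a.1.1 ≤ m)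
    (hb : m ≤ b.1.1) : ∃ c e : Site, Conn ω a e ∧ e.1.1 = m ∧ Conn ω c b ∧
      (c = e ∨ (c.1.1 = m + 1 ∧ c.1.2 + 1 = e.1.2)) := by
  induction h with
  | refl => exact ⟨a, a, .refl, by omega, .refl, Or.inl rfl⟩
  | @tail d b had hdb ih =>
    by_cases hd : m ≤ d.1.1
    · obtain ⟨c, e, h1, h2, h3, h4⟩ := ih hd
      exact ⟨c, e, h1, h2, h3.tail hdb, h4⟩
    · by_cases hbm : b.1.1 = m
      · exact ⟨b, b, had.tail hdb, hbm, .refl, Or.inl rfl⟩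
      · have hd0 := d.2.1
        have hs := site_mod d
        have hst : b.1.1 = d.1.1 + 1 ∨ (b.1.1 = d.1.1 + 2 ∧ b.1.2 = d.1.2) := by
          rcases hdb.2 with h | h | h <;> simp [h]
        let e : Site := ⟨(d.1.1 + 1, d.1.2 + 1), by simp only; omega, by
          simp only [Int.even_iff]; omega⟩
        refine ⟨b, e, had.tail ⟨hdb.1, Or.inl rfl⟩, ?_, .refl, Or.inr ?_⟩
        · change d.1.1 + 1 = m
          omega
        · change _ ∧ b.1.2 + 1 = d.1.2 + 1
          omega

lemma measurableSet_mem_xiBar (n : ℕ) (x : ℤ) :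
    MeasurableSet[siteSigma (columns 0 n)] {ω | x ∈ xiBar ω n} := by
  have h : {ω | x ∈ xiBar ω n} = ⋃ a : Site, ⋃ b : Site, {ω | (a.1.1 = 0 ∨ a.1.1 = 1) ∧
      a.1.2 ≤ 0 ∧ b.1 = ((n : ℤ), x) ∧ Conn ω a b} := by
    ext ω; simp [xiBar]
  rw [h]
  refine @MeasurableSet.iUnion _ _ (siteSigma _) _ _ fun a =>
    @MeasurableSet.iUnion _ _ (siteSigma _) _ _ fun b => ?_
  by_cases hb : b.1 = ((n : ℤ), x)
  · simp only [Set.ofPred_and, hb]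
    refine @MeasurableSet.inter _ (siteSigma _) _ _ (@MeasurableSet.const _ (siteSigma _) _) ?_
    refine @MeasurableSet.inter _ (siteSigma _) _ _ (@MeasurableSet.const _ (siteSigma _) _) ?_
    refine @MeasurableSet.inter _ (siteSigma _) _ _ (@MeasurableSet.const _ (siteSigma _) _) ?_
    have hsub : columns a.1.1 b.1.1 ⊆ columns 0 n := fun s hs => by
      have := hs.2
      rw [hb] at this
      exact ⟨a.2.1.trans hs.1, this⟩
    exact siteSigma_mono hsub _ (measurableSet_conn a b)
  · simp only [hb, false_and, and_false, Set.ofPred_false]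
    exact @MeasurableSet.empty _ (siteSigma _)

/-- The event that `x` is the highest point of `xiBar ω n`. -/
def edgeAt (n : ℕ) (x : ℤ) : Set Config :=
  {ω | x ∈ xiBar ω n ∧ ∀ y, x < y → y ∉ xiBar ω n}

lemma measurableSet_edgeAt (n : ℕ) (x : ℤ) :
    MeasurableSet[siteSigma (columns 0 n)] (edgeAt n x) := by
  have h : edgeAt n x = {ω | x ∈ xiBar ω n} ∩ ⋂ y : ℤ, ⋂ _ : x < y, {ω | y ∈ xiBar ω n}ᶜ := by
    ext ω; simp [edgeAt]
  rw [h]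
  refine @MeasurableSet.inter _ (siteSigma _) _ _ (measurableSet_mem_xiBar n x) ?_
  refine @MeasurableSet.iInter _ _ (siteSigma _) _ _ fun y =>
    @MeasurableSet.iInter _ _ (siteSigma _) _ _ fun _ => ?_
  exact @MeasurableSet.compl _ _ (siteSigma _) (measurableSet_mem_xiBar n y)

lemma exists_edgeAt {ω : Config} {n : ℕ} {x : ℤ} (hx : x ∈ xiBar ω n) :
    ∃ y, ω ∈ edgeAt n y := by
  obtain ⟨y, hy, hmax⟩ := Int.exists_greatest_of_bdd (P := fun y => y ∈ xiBar ω n)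
    ⟨n, fun y hy => le_of_mem_xiBar hy⟩ ⟨x, hx⟩
  exact ⟨y, hy, fun w hw h => by have := hmax w h; omega⟩

lemma edgeAt_unique {ω : Config} {n : ℕ} {x y : ℤ} (hx : ω ∈ edgeAt n x)
    (hy : ω ∈ edgeAt n y) : x = y := by
  rcases lt_trichotomy x y with h | h | h
  · exact absurd hy.1 (hx.2 y h)
  · exact h
  · exact absurd hx.1 (hy.2 x h)

/-- The right edge at level `m + n` is that of a process started afresh from below the right edge
at level `m`. -/
lemma sub_mem_xiBar_shift {ω : Config} {m n : ℕ} (hm : 1 ≤ m) {c : Site} (hc : c.1.1 = m)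
    (hω : ω ∈ edgeAt m c.1.2) {x : ℤ} (hx : x ∈ xiBar ω (m + n)) :
    x - c.1.2 ∈ xiBar (shift c ω) n := by
  obtain ⟨a, b, ha, ha', hb, hab⟩ := hx
  have hb1 : b.1.1 = m + n := by rw [hb]; push_cast; rfl
  have hb2 : b.1.2 = x := by rw [hb]
  -- If the path jumps over column `m`, it lands in column `m + 1` one below a reached site `e`,
  -- hence below the edge. This is why the process starts from columns `0` and `1`. The cut needs `1
  -- ≤ m` since the path may itself start in column `1`.
  obtain ⟨d, e, hae, he, hdb, hde⟩ := hab.cut (m := m) (by omega) (by omega)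
  have hey : e.1.2 ≤ c.1.2 := by
    by_contra hlt
    exact hω.2 e.1.2 (by omega) ⟨a, e, ha, ha', Prod.ext he rfl, hae⟩
  have hcd : c.1.1 ≤ d.1.1 := by
    rcases hde with rfl | h <;> omega
  refine ⟨untranslate c d hcd, untranslate c b (hcd.trans hdb.fst_le), ?_, ?_, ?_,
    hdb.untranslate hcd⟩
  · rcases hde with rfl | h <;> simp only [untranslate] <;> omega
  · rcases hde with rfl | h <;> simp only [untranslate] <;> omega
  · simp only [untranslate, hb1, hb2, hc]
    simp

/-- The exponential of `t` times the right edge. -/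
def expEdge (t : ℝ) (n : ℕ) (ω : Config) : ℝ≥0∞ :=
  ⨆ x ∈ xiBar ω n, ENNReal.ofReal (Real.exp (t * x))

lemma measurable_iSup_mem_xiBar {β : Type*} [MeasurableSpace β] [TopologicalSpace β]
    [BorelSpace β] [CompleteLinearOrder β] [OrderTopology β] [SecondCountableTopology β]
    (n : ℕ) (g : ℤ → β) : Measurable fun ω : Config => ⨆ x ∈ xiBar ω n, g x := by
  classical
  refine Measurable.iSup fun x => ?_
  have h : (fun ω : Config => ⨆ _ : x ∈ xiBar ω n, g x) =
      fun ω => if x ∈ xiBar ω n then g x else ⊥ := by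
    funext ω; exact iSup_eq_if _
  rw [h]
  exact Measurable.ite (siteSigma_le _ _ (measurableSet_mem_xiBar n x)) measurable_const
    measurable_const

lemma measurable_expEdge (t : ℝ) (n : ℕ) : Measurable (expEdge t n) :=
  measurable_iSup_mem_xiBar n fun x => ENNReal.ofReal (Real.exp (t * x))

/-- The exponential moment of the right edge. -/
def edgeMoment (p : unitInterval) (t : ℝ) (n : ℕ) : ℝ≥0∞ := ∫⁻ ω, expEdge t n ω ∂law p

lemma expEdge_le_mul {ω : Config} {m n : ℕ} (hm : 1 ≤ m) {c : Site} (hc : c.1.1 = m)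
    (hω : ω ∈ edgeAt m c.1.2) (t : ℝ) :
    expEdge t (m + n) ω ≤ ENNReal.ofReal (Real.exp (t * c.1.2)) * expEdge t n (shift c ω) := by
  refine iSup₂_le fun x hx => ?_
  have h := sub_mem_xiBar_shift hm hc hω hx
  have e : t * x = t * c.1.2 + t * ((x - c.1.2 : ℤ) : ℝ) := by push_cast; ring
  rw [e, Real.exp_add, ENNReal.ofReal_mul (Real.exp_pos _).le]
  gcongr
  exact le_iSup₂_of_le (f := fun (y : ℤ) (_ : y ∈ xiBar (shift c ω) n) =>
    ENNReal.ofReal (Real.exp (t * y))) (x - c.1.2) h le_rfl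

/-- Split according to the position `c` of the edge at level `m`. That event lives on the columns
before `m`, and the process restarted at `c` on the columns from `m` on, so the factors are
independent. An empty level contributes `0`, in line with `exp(-∞)`. -/
lemma edgeMoment_add_le (p : unitInterval) (t : ℝ) {m : ℕ} (hm : 1 ≤ m) (n : ℕ) :
    edgeMoment p t (m + n) ≤ edgeMoment p t m * edgeMoment p t n := by
  let F : {c : Site // c.1.1 = m} → Config → ℝ≥0∞ := fun c =>
    (edgeAt m c.1.1.2).indicator fun _ => ENNReal.ofReal (Real.exp (t * c.1.1.2))
  have hF : ∀ c, Measurable[siteSigma (columns 0 m)] (F c) := fun c => by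
    let _ : MeasurableSpace Config := siteSigma (columns 0 m)
    exact Measurable.indicator measurable_const (measurableSet_edgeAt m _)
  have hF' : ∀ c, Measurable (F c) := fun c => (hF c).mono (siteSigma_le _) le_rfl
  have hG : ∀ c : {c : Site // c.1.1 = m},
      Measurable[siteSigma {s | (m : ℤ) ≤ s.1.1}] fun ω => expEdge t n (shift c.1 ω) := by
    intro c
    refine measurable_siteSigma_shift (measurable_expEdge t n) c.1 fun a => ?_
    have h1 := a.2.1
    have h2 := c.2
    simp only [translate, Set.mem_ofPred_eq]
    omega
  have hG' : ∀ c : {c : Site // c.1.1 = m}, Measurable fun ω => expEdge t n (shift c.1 ω) :=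
    fun c => (hG c).mono (siteSigma_le _) le_rfl
  have hd : Disjoint (columns 0 m) {s : Site | (m : ℤ) ≤ s.1.1} := by
    rw [Set.disjoint_left]
    exact fun s hs hs' => absurd hs.2 (not_lt.2 hs')
  have hsite : ∀ {ω : Config} {x : ℤ}, ω ∈ edgeAt m x →
      ∃ c : {c : Site // c.1.1 = m}, c.1.1.2 = x := by
    intro ω x hx
    obtain ⟨-, b, -, -, hb, -⟩ := hx.1
    exact ⟨⟨b, by rw [hb]⟩, by simp only [hb]⟩
  calc edgeMoment p t (m + n)
      ≤ ∫⁻ ω, ∑' c, F c ω * expEdge t n (shift c.1 ω) ∂law p := by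
        refine lintegral_mono fun ω => ?_
        by_cases h : ∃ x, x ∈ xiBar ω (m + n)
        · obtain ⟨x, hx⟩ := h
          have hne : ∃ y, y ∈ xiBar ω m := by
            obtain ⟨a, b, ha, ha', hb, hab⟩ := hx
            have hb1 : b.1.1 = m + n := by rw [hb]; push_cast; rfl
            obtain ⟨d, e, hae, he, -⟩ := hab.cut (m := m) (by omega) (by omega)
            exact ⟨e.1.2, a, e, ha, ha', Prod.ext he rfl, hae⟩
          obtain ⟨y, hy⟩ := exists_edgeAt hne.choose_spec
          obtain ⟨c, rfl⟩ := hsite hy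
          refine le_trans ?_ (ENNReal.le_tsum c)
          simp only [F, Set.indicator_of_mem hy]
          exact expEdge_le_mul hm c.2 hy t
        · push Not at h
          have h0 : expEdge t (m + n) ω = 0 := by simp [expEdge, h]
          simp [h0]
    _ = ∑' c, ∫⁻ ω, F c ω * expEdge t n (shift c.1 ω) ∂law p :=
        lintegral_tsum fun c => ((hF' c).mul (hG' c)).aemeasurable
    _ = ∑' c, (∫⁻ ω, F c ω ∂law p) * edgeMoment p t n := by
        refine tsum_congr fun c => ?_
        have h := lintegral_mul_eq_lintegral_mul_lintegral_of_indepFun (hF' c) (hG' c)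
          (indepFun_of_siteSigma p (hF c) (hG c) hd)
        have h2 : ∫⁻ ω, expEdge t n (shift c.1 ω) ∂law p = edgeMoment p t n :=
          (measurePreserving_shift p c.1).lintegral_comp (measurable_expEdge t n)
        rw [← h2]
        exact h
    _ = (∫⁻ ω, ∑' c, F c ω ∂law p) * edgeMoment p t n := by
        rw [ENNReal.tsum_mul_right, lintegral_tsum fun c => (hF' c).aemeasurable]
    _ ≤ edgeMoment p t m * edgeMoment p t n := by
        gcongr
        refine lintegral_mono fun ω => ?_
        by_cases h : ∃ c : {c : Site // c.1.1 = m}, ω ∈ edgeAt m c.1.1.2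
        · obtain ⟨c, hc⟩ := h
          have hz : ∀ d, d ≠ c → F d ω = 0 := fun d hdc => by
            refine Set.indicator_of_notMem (fun hd => hdc ?_) _
            exact Subtype.ext (site_ext (d.2.trans c.2.symm) (edgeAt_unique hd hc))
          simp only [tsum_eq_single c hz, F, Set.indicator_of_mem hc]
          exact le_iSup₂_of_le (f := fun (y : ℤ) (_ : y ∈ xiBar ω m) =>
            ENNReal.ofReal (Real.exp (t * y))) c.1.1.2 hc.1 le_rfl
        · push Not at h
          have hz : ∀ c, F c ω = 0 := fun c => Set.indicator_of_notMem (h c) _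
          simp [hz]

lemma edgeMoment_le_exp (p : unitInterval) {t : ℝ} (ht : 0 ≤ t) (n : ℕ) :
    edgeMoment p t n ≤ ENNReal.ofReal (Real.exp (t * n)) := by
  calc edgeMoment p t n ≤ ∫⁻ _, ENNReal.ofReal (Real.exp (t * n)) ∂law p := by
        refine lintegral_mono fun ω => iSup₂_le fun x hx => ?_
        have : (x : ℝ) ≤ n := by exact_mod_cast le_of_mem_xiBar hx
        gcongr
    _ = _ := by simp

/-- The exponential moments grow at most geometrically, at the rate seen at a single level. -/
lemma edgeMoment_le_of_le (p : unitInterval) {t a : ℝ} (ht : 0 ≤ t) (ha : 0 ≤ a) {m : ℕ}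
    (hm : 1 ≤ m) (h : edgeMoment p t m ≤ ENNReal.ofReal (Real.exp (t * (a * m)))) (n : ℕ) :
    edgeMoment p t n ≤ ENNReal.ofReal (Real.exp (t * m) * Real.exp (t * (a * n))) := by
  induction n using Nat.strong_induction_on with
  | _ n ih =>
    by_cases hn : n < m
    · refine (edgeMoment_le_exp p ht n).trans (ENNReal.ofReal_le_ofReal ?_)
      have h1 : Real.exp (t * n) ≤ Real.exp (t * m) := by gcongr
      have h2 : 1 ≤ Real.exp (t * (a * n)) := Real.one_le_exp (by positivity)
      nlinarith [Real.exp_pos (t * m)]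
    · have hmn : m ≤ n := not_lt.1 hn
      calc edgeMoment p t n = edgeMoment p t (m + (n - m)) := by rw [Nat.add_sub_cancel' hmn]
        _ ≤ edgeMoment p t m * edgeMoment p t (n - m) := edgeMoment_add_le p t hm _
        _ ≤ ENNReal.ofReal (Real.exp (t * (a * m))) *
            ENNReal.ofReal (Real.exp (t * m) * Real.exp (t * (a * (n - m : ℕ)))) := by
          gcongr
          exact ih _ (by omega)
        _ = _ := by
          rw [← ENNReal.ofReal_mul (Real.exp_pos _).le, ← Real.exp_add, ← Real.exp_add,
            ← Real.exp_add]
          congr 2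
          push_cast [hmn]
          ring

/-- The event that the right edge at level `n` is at or above `r`. -/
def edgeGE (n : ℕ) (r : ℝ) : Set Config := {ω | ∃ x ∈ xiBar ω n, r ≤ (x : ℝ)}

lemma measurableSet_edgeGE (n : ℕ) (r : ℝ) : MeasurableSet (edgeGE n r) := by
  have h : edgeGE n r = ⋃ x : ℤ, ⋃ _ : r ≤ (x : ℝ), {ω | x ∈ xiBar ω n} := by
    ext ω; simp [edgeGE, and_comm]
  rw [h]
  exact MeasurableSet.iUnion fun x => MeasurableSet.iUnion fun _ =>
    siteSigma_le _ _ (measurableSet_mem_xiBar n x)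

lemma law_edgeGE_le (p : unitInterval) {t : ℝ} (ht : 0 ≤ t) (n : ℕ) (r : ℝ) :
    law p (edgeGE n r) ≤ ENNReal.ofReal (Real.exp (-(t * r))) * edgeMoment p t n := by
  have h1 := mul_meas_ge_le_lintegral (μ := law p) (measurable_expEdge t n)
    (ENNReal.ofReal (Real.exp (t * r)))
  have hsub : edgeGE n r ⊆ {ω | ENNReal.ofReal (Real.exp (t * r)) ≤ expEdge t n ω} := by
    rintro ω ⟨x, hx, hr⟩
    refine le_iSup₂_of_le (f := fun (y : ℤ) (_ : y ∈ xiBar ω n) =>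
      ENNReal.ofReal (Real.exp (t * y))) x hx ?_
    gcongr
  calc law p (edgeGE n r)
      = ENNReal.ofReal (Real.exp (-(t * r))) *
          (ENNReal.ofReal (Real.exp (t * r)) * law p (edgeGE n r)) := by
        rw [← mul_assoc, ← ENNReal.ofReal_mul (Real.exp_pos _).le, ← Real.exp_add]
        simp
    _ ≤ _ := by
        gcongr
        exact (mul_le_mul_right (measure_mono hsub) _).trans h1

/-! ### Concentration of the right edge -/

/-- The right edge at level `n`, divided by `n`. -/
def edgeRate (n : ℕ) (ω : Config) : EReal := ⨆ x ∈ xiBar ω n, ((x / n : ℝ) : EReal)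

lemma measurable_edgeRate (n : ℕ) : Measurable (edgeRate n) :=
  measurable_iSup_mem_xiBar n fun x => ((x / n : ℝ) : EReal)

lemma edgeRate_eq_of_mem_edgeAt {ω : Config} {n : ℕ} {y : ℤ} (hy : ω ∈ edgeAt n y) :
    edgeRate n ω = ((y / n : ℝ) : EReal) := by
  refine le_antisymm (iSup₂_le fun x hx => ?_) (le_iSup₂_of_le
    (f := fun (x : ℤ) (_ : x ∈ xiBar ω n) => ((x / n : ℝ) : EReal)) y hy.1 le_rfl)
  have hxy : (x : ℝ) ≤ y := by
    exact_mod_cast le_of_not_gt fun h => hy.2 x h hx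
  exact EReal.coe_le_coe_iff.2 (by gcongr)

lemma uBar_eq_of_mem_edgeAt {ω : Config} {n : ℕ} {y : ℤ} (hy : ω ∈ edgeAt n y) :
    uBar ω n = ((y : ℝ) : EReal) := by
  refine le_antisymm (sSup_le ?_) (le_sSup ⟨y, hy.1, rfl⟩)
  rintro _ ⟨x, hx, rfl⟩
  have hxy : (x : ℝ) ≤ y := by
    exact_mod_cast le_of_not_gt fun h => hy.2 x h hx
  exact EReal.coe_le_coe_iff.2 hxy

lemma edgeAt_or_empty (n : ℕ) (ω : Config) : (∃ y, ω ∈ edgeAt n y) ∨ xiBar ω n = ∅ := by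
  rcases Set.eq_empty_or_nonempty (xiBar ω n) with h | ⟨x, hx⟩
  · exact Or.inr h
  · exact Or.inl (exists_edgeAt hx)

lemma uBar_div_eq {n : ℕ} (hn : 1 ≤ n) (ω : Config) : uBar ω n / (n : EReal) = edgeRate n ω := by
  rcases edgeAt_or_empty n ω with ⟨y, hy⟩ | h
  · rw [uBar_eq_of_mem_edgeAt hy, edgeRate_eq_of_mem_edgeAt hy, EReal.coe_div]
    rfl
  · have h1 : uBar ω n = ⊥ := by simp [uBar, h]
    have h2 : edgeRate n ω = ⊥ := by simp [edgeRate, h]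
    rw [h1, h2]
    exact EReal.bot_div_of_pos_ne_top (by exact_mod_cast hn) (EReal.natCast_ne_top n)

lemma toENNReal_le_one {x : EReal} (h : x ≤ 1) : x.toENNReal ≤ 1 :=
  (EReal.toENNReal_le_toENNReal (show x ≤ ((1 : ℝ) : EReal) from h)).trans_eq
    (by rw [EReal.real_coe_toENNReal, ENNReal.ofReal_one])

lemma edgeRate_le_one (n : ℕ) (ω : Config) : edgeRate n ω ≤ 1 := by
  refine iSup₂_le fun x hx => ?_
  have h : (x : ℝ) ≤ n := by exact_mod_cast le_of_mem_xiBar hx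
  exact_mod_cast div_le_one_of_le₀ h (Nat.cast_nonneg n)

lemma slope_eq (p : unitInterval) :
    slope p = ⨅ n : ℕ, ⨅ _ : 1 ≤ n, expect (law p) (edgeRate n) := by
  unfold slope
  refine iInf_congr fun n => iInf_congr fun hn => ?_
  congr 1
  funext ω
  exact uBar_div_eq hn ω

/-- If `f ≤ 1` has expectation less than `a`, then so has a truncation of `f` from below. -/
lemma exists_truncation {μ : Measure Config} [IsProbabilityMeasure μ] {f : Config → EReal}
    (hf : Measurable f) (hf1 : ∀ ω, f ω ≤ 1) {a : ℝ} (h : expect μ f < a) :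
    ∃ (R : ℝ) (Y : Config → ℝ), 0 < R ∧ Measurable Y ∧ (∀ ω, |Y ω| ≤ R) ∧
      (∀ ω (r : ℝ), (r : EReal) ≤ f ω → r ≤ Y ω) ∧ ∫ ω, Y ω ∂μ < a := by
  set P : Config → ℝ≥0∞ := fun ω => (f ω).toENNReal with hP
  set Q : Config → ℝ≥0∞ := fun ω => (-f ω).toENNReal with hQ
  have hPm : Measurable P := hf.ereal_toENNReal
  have hQm : Measurable Q := hf.neg.ereal_toENNReal
  have hP1 : ∀ ω, P ω ≤ 1 := fun ω => toENNReal_le_one (hf1 ω)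
  have hA1 : ∫⁻ ω, P ω ∂μ ≤ 1 := by
    calc ∫⁻ ω, P ω ∂μ ≤ ∫⁻ _, 1 ∂μ := lintegral_mono hP1
      _ = 1 := by simp
  set A := ∫⁻ ω, P ω ∂μ with hA
  have hAtop : A ≠ ∞ := (hA1.trans_lt ENNReal.one_lt_top).ne
  have hmin : ∫⁻ ω, Q ω ∂μ = ⨆ K : ℕ, ∫⁻ ω, min (Q ω) K ∂μ := by
    rw [← lintegral_iSup (fun K => hQm.min measurable_const)]
    · refine lintegral_congr fun ω => ?_
      rw [← inf_iSup_eq, ENNReal.iSup_natCast, inf_top_eq]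
    · intro K K' hKK' ω
      exact min_le_min le_rfl (by exact_mod_cast hKK')
  have hKtop : ∀ K : ℕ, ∫⁻ ω, min (Q ω) K ∂μ ≠ ∞ := fun K => by
    refine ((lintegral_mono fun ω => min_le_right (Q ω) (K : ℝ≥0∞)).trans_lt ?_).ne
    simp
  -- The negative part is cut off at `K`; by monotone convergence its mean is eventually large
  -- enough, also when it is infinite.
  obtain ⟨K, hK⟩ : ∃ K : ℕ, A.toReal - (∫⁻ ω, min (Q ω) K ∂μ).toReal < a := by
    by_cases hneg : A.toReal - a < 0
    · exact ⟨0, by simp; linarith⟩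
    · have hlt : ENNReal.ofReal (A.toReal - a) < ∫⁻ ω, Q ω ∂μ := by
        by_contra hle
        rw [not_lt] at hle
        have h1 : ((∫⁻ ω, Q ω ∂μ : ℝ≥0∞) : EReal) ≤ ((A.toReal - a : ℝ) : EReal) := by
          have := EReal.coe_ennreal_le_coe_ennreal_iff.2 hle
          rwa [EReal.coe_ennreal_ofReal, max_eq_left (not_lt.1 hneg)] at this
        have h2 : (A : EReal) - ((A.toReal - a : ℝ) : EReal) ≤ expect μ f :=
          EReal.sub_le_sub le_rfl h1
        have h3 : (A : EReal) = ((A.toReal : ℝ) : EReal) :=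
          (EReal.coe_ennreal_toReal hAtop).symm
        rw [h3, ← EReal.coe_sub, sub_sub_cancel] at h2
        exact absurd h (not_lt.2 h2)
      rw [hmin, lt_iSup_iff] at hlt
      obtain ⟨K, hK⟩ := hlt
      refine ⟨K, ?_⟩
      have := (ENNReal.ofReal_lt_iff_lt_toReal (not_lt.1 hneg) (hKtop K)).1 hK
      linarith
  refine ⟨K + 1, fun ω => (P ω).toReal - (min (Q ω) K).toReal, by positivity,
    hPm.ennreal_toReal.sub (hQm.min measurable_const).ennreal_toReal, fun ω => ?_,
    fun ω r hr => ?_, ?_⟩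
  · have h1 : (P ω).toReal ≤ 1 := ENNReal.toReal_le_of_le_ofReal zero_le_one (by simpa using hP1 ω)
    have h2 : (min (Q ω) K).toReal ≤ K :=
      ENNReal.toReal_le_of_le_ofReal (Nat.cast_nonneg K) (by simp)
    have h3 := ENNReal.toReal_nonneg (a := P ω)
    have h4 := ENNReal.toReal_nonneg (a := min (Q ω) K)
    rw [abs_le]
    constructor <;> linarith [(Nat.cast_nonneg K : (0 : ℝ) ≤ K)]
  · have hbot : f ω ≠ ⊥ := fun h => by rw [h] at hr; simp at hr
    have htop : f ω ≠ ⊤ := ((hf1 ω).trans_lt (EReal.coe_lt_top 1)).ne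
    obtain ⟨s, hs⟩ : ∃ s : ℝ, f ω = s := ⟨(f ω).toReal, (EReal.coe_toReal htop hbot).symm⟩
    rw [hs, EReal.coe_le_coe_iff] at hr
    have hPs : (P ω).toReal = max s 0 := by
      simp [hP, hs, ENNReal.toReal_ofReal']
    have hQs : (min (Q ω) K).toReal ≤ max (-s) 0 := by
      have : Q ω = ENNReal.ofReal (-s) := by
        simp only [hQ, hs, ← EReal.coe_neg, EReal.real_coe_toENNReal]
      rw [this, ← ENNReal.toReal_ofReal']
      exact ENNReal.toReal_mono ENNReal.ofReal_ne_top (min_le_left _ _)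
    simp only [hPs]
    have : max s 0 - max (-s) 0 = s := by
      rcases le_total 0 s with h | h
      · rw [max_eq_left h, max_eq_right (by linarith)]; ring
      · rw [max_eq_right h, max_eq_left (by linarith)]; ring
    linarith
  · rw [integral_sub, integral_toReal hPm.aemeasurable, integral_toReal]
    · exact hK
    · exact (hQm.min measurable_const).aemeasurable
    · exact .of_forall fun ω => (min_le_right _ _).trans_lt (ENNReal.natCast_lt_top K)
    · exact .of_forall fun ω => (hP1 ω).trans_lt ENNReal.one_lt_top
    · exact integrable_toReal_of_lintegral_ne_top hPm.aemeasurable hAtop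
    · exact integrable_toReal_of_lintegral_ne_top (hQm.min measurable_const).aemeasurable
        (hKtop K)

lemma exists_edgeMoment_le (p : unitInterval) {m : ℕ} (hm : 1 ≤ m) {a : ℝ}
    (h : expect (law p) (edgeRate m) < a) :
    ∃ t : ℝ, 0 < t ∧ edgeMoment p t m ≤ ENNReal.ofReal (Real.exp (t * (a * m))) := by
  obtain ⟨R, Y, hR, hYm, hYR, hfY, hYa⟩ :=
    exists_truncation (measurable_edgeRate m) (edgeRate_le_one m) h
  have hm0 : (0 : ℝ) < m := by exact_mod_cast hm
  set E := ∫ ω, Y ω ∂law p with hE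
  -- `s R ≤ 1` validates the second-order bound on the exponential, and `s R² ≤ a - E` lets the
  -- quadratic error be absorbed: `1 + sE + (sR)² ≤ 1 + sa ≤ exp(sa)`.
  set s := min (1 / R) ((a - E) / R ^ 2) with hs
  have hs0 : 0 < s := lt_min (by positivity) (div_pos (by linarith) (by positivity))
  have hsR : s * R ≤ 1 := by
    rw [← le_div_iff₀ hR]; exact min_le_left _ _
  have hsR2 : s * R ^ 2 ≤ a - E := by
    rw [← le_div_iff₀ (by positivity)]; exact min_le_right _ _
  have hYi : Integrable Y (law p) :=
    Integrable.of_bound hYm.aestronglyMeasurable R (.of_forall fun ω => by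
      rw [Real.norm_eq_abs]; exact hYR ω)
  have hexp : ∀ ω, Real.exp (s * Y ω) ≤ 1 + s * Y ω + (s * R) ^ 2 := fun ω => by
    have h1 : |s * Y ω| ≤ s * R := by
      rw [abs_mul, abs_of_pos hs0]; exact mul_le_mul_of_nonneg_left (hYR ω) hs0.le
    have h2 := abs_le.1 (Real.abs_exp_sub_one_sub_id_le (h1.trans hsR))
    have h3 : (s * Y ω) ^ 2 ≤ (s * R) ^ 2 := sq_le_sq' (by linarith [(abs_le.1 h1).1]) (abs_le.1 h1).2
    linarith [h2.2]
  refine ⟨s / m, by positivity, ?_⟩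
  calc edgeMoment p (s / m) m
      ≤ ∫⁻ ω, ENNReal.ofReal (1 + s * Y ω + (s * R) ^ 2) ∂law p := by
        refine lintegral_mono fun ω => iSup₂_le fun x hx => ENNReal.ofReal_le_ofReal ?_
        refine le_trans ?_ (hexp ω)
        have h1 : (x / m : ℝ) ≤ Y ω := hfY ω _ (le_iSup₂_of_le
          (f := fun (x : ℤ) (_ : x ∈ xiBar ω m) => ((x / m : ℝ) : EReal)) x hx le_rfl)
        have h2 : s / m * x = s * (x / m) := by ring
        rw [h2]
        gcongr
    _ = ENNReal.ofReal (∫ ω, (1 + s * Y ω + (s * R) ^ 2) ∂law p) := by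
        rw [ofReal_integral_eq_lintegral_ofReal]
        · exact ((integrable_const _).add (hYi.const_mul s)).add (integrable_const _)
        · exact .of_forall fun ω => (Real.exp_pos _).le.trans (hexp ω)
    _ ≤ _ := by
        refine ENNReal.ofReal_le_ofReal ?_
        have hi : ∫ ω, (1 + s * Y ω + (s * R) ^ 2) ∂law p = 1 + s * E + (s * R) ^ 2 := by
          have e1 : ∫ ω, (1 + s * Y ω + (s * R) ^ 2) ∂law p =
              ∫ ω, (1 + s * Y ω) ∂law p + ∫ _, (s * R) ^ 2 ∂law p :=
            integral_add ((integrable_const _).add (hYi.const_mul s)) (integrable_const _)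
          have e2 : ∫ ω, (1 + s * Y ω) ∂law p = ∫ _, 1 ∂law p + ∫ ω, s * Y ω ∂law p :=
            integral_add (integrable_const _) (hYi.const_mul s)
          rw [e1, e2, integral_const_mul]
          simp [hE]
        rw [hi]
        have h3 : s / m * (a * m) = s * a := by field_simp
        rw [h3]
        have h4 := Real.add_one_le_exp (s * a)
        have h5 := mul_le_mul_of_nonneg_left hsR2 hs0.le
        nlinarith

section Slope

variable {p : unitInterval} {α : ℝ}

lemma exists_edgeGE_le (h : slope p = (α : EReal)) (hα : 0 < α) {γ : ℝ} (hγ : 0 < γ) :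
    ∃ t C : ℝ, 0 < t ∧ 0 < C ∧ ∀ (n : ℕ) (r : ℝ),
      law p (edgeGE n (α * n + r)) ≤ ENNReal.ofReal (C * Real.exp (t * (γ * n - r))) := by
  have hlt : slope p < ((α + γ : ℝ) : EReal) := by
    rw [h]; exact EReal.coe_lt_coe_iff.2 (by linarith)
  rw [slope_eq] at hlt
  simp only [iInf_lt_iff] at hlt
  obtain ⟨m, hm, hlt⟩ := hlt
  obtain ⟨t, ht, hM⟩ := exists_edgeMoment_le p hm hlt
  refine ⟨t, Real.exp (t * m), ht, Real.exp_pos _, fun n r => ?_⟩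
  calc law p (edgeGE n (α * n + r))
      ≤ ENNReal.ofReal (Real.exp (-(t * (α * n + r)))) * edgeMoment p t n :=
        law_edgeGE_le p ht.le n _
    _ ≤ ENNReal.ofReal (Real.exp (-(t * (α * n + r)))) *
        ENNReal.ofReal (Real.exp (t * m) * Real.exp (t * ((α + γ) * n))) := by
        gcongr
        exact edgeMoment_le_of_le p ht.le (by positivity) hm hM n
    _ = _ := by
        rw [← ENNReal.ofReal_mul (Real.exp_pos _).le, ← Real.exp_add, ← Real.exp_add,
          ← Real.exp_add]
        congr 2
        ring

lemma toENNReal_edgeRate_le {a b : ℝ} (hb : 0 < b) (hab : b < a) {n : ℕ} (hn : 1 ≤ n)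
    (ω : Config) : (edgeRate n ω).toENNReal ≤ ENNReal.ofReal b +
      (edgeGE n (b * n)).indicator (fun _ => ENNReal.ofReal (a - b)) ω +
      (edgeGE n (a * n)).indicator (fun _ => 1) ω := by
  have hn0 : (0 : ℝ) < n := by exact_mod_cast hn
  by_cases h1 : ω ∈ edgeGE n (a * n)
  · rw [Set.indicator_of_mem h1]
    refine le_trans ?_ le_add_self
    exact toENNReal_le_one (edgeRate_le_one n ω)
  · rcases edgeAt_or_empty n ω with ⟨y, hy⟩ | he
    · rw [edgeRate_eq_of_mem_edgeAt hy, EReal.real_coe_toENNReal]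
      have hya : (y : ℝ) < a * n := by
        by_contra hc
        exact h1 ⟨y, hy.1, not_lt.1 hc⟩
      by_cases h2 : ω ∈ edgeGE n (b * n)
      · rw [Set.indicator_of_mem h2, ← ENNReal.ofReal_add hb.le (by linarith)]
        refine le_trans (ENNReal.ofReal_le_ofReal ?_) le_self_add
        rw [div_le_iff₀ hn0]
        linarith
      · have hyb : (y : ℝ) < b * n := by
          by_contra hc
          exact h2 ⟨y, hy.1, not_lt.1 hc⟩
        rw [add_assoc]
        refine le_trans (ENNReal.ofReal_le_ofReal ?_) le_self_add
        rw [div_le_iff₀ hn0]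
        exact hyb.le
    · simp [edgeRate, he]

/-- The mean rate is at least `α`, while the rate is at most `b`, `a` or `1` according to which of
the levels `bn`, `an` the edge has reached. -/
lemma real_compl_edgeGE_le (h : slope p = (α : EReal)) {a b : ℝ} (hb : 0 < b) (hbα : b < α)
    (hαa : α < a) {n : ℕ} (hn : 1 ≤ n) :
    (α - b) * (law p).real (edgeGE n (b * n))ᶜ ≤ a - α + (law p).real (edgeGE n (a * n)) := by
  have h1 : (α : EReal) ≤ expect (law p) (edgeRate n) := by
    rw [← h, slope_eq]
    exact iInf₂_le n hn
  have h2 : expect (law p) (edgeRate n) ≤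
      ((∫⁻ ω, (edgeRate n ω).toENNReal ∂law p : ℝ≥0∞) : EReal) := by
    have := EReal.sub_le_sub
      (le_refl ((∫⁻ ω, (edgeRate n ω).toENNReal ∂law p : ℝ≥0∞) : EReal))
      (EReal.coe_ennreal_nonneg (∫⁻ ω, (-edgeRate n ω).toENNReal ∂law p))
    rwa [sub_zero] at this
  have h3 : ENNReal.ofReal α ≤ ∫⁻ ω, (edgeRate n ω).toENNReal ∂law p := by
    rw [← EReal.coe_ennreal_le_coe_ennreal_iff, EReal.coe_ennreal_ofReal,
      max_eq_left (hb.trans hbα).le]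
    exact h1.trans h2
  have h4 : ∫⁻ ω, (edgeRate n ω).toENNReal ∂law p ≤
      ENNReal.ofReal b + ENNReal.ofReal (a - b) * law p (edgeGE n (b * n)) +
        law p (edgeGE n (a * n)) := by
    refine (lintegral_mono (toENNReal_edgeRate_le hb (hbα.trans hαa) hn)).trans_eq ?_
    rw [lintegral_add_right _ (measurable_const.indicator (measurableSet_edgeGE _ _)),
      lintegral_add_right _ (measurable_const.indicator (measurableSet_edgeGE _ _)),
      lintegral_indicator_const (measurableSet_edgeGE _ _),
      lintegral_indicator_const (measurableSet_edgeGE _ _)]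
    simp
  have hab : 0 ≤ a - b := by linarith
  have h5 : ENNReal.ofReal α ≤ ENNReal.ofReal
      (b + (a - b) * (law p).real (edgeGE n (b * n)) + (law p).real (edgeGE n (a * n))) := by
    refine (h3.trans h4).trans_eq ?_
    rw [ENNReal.ofReal_add (by positivity) measureReal_nonneg, ENNReal.ofReal_add hb.le
      (by positivity), ENNReal.ofReal_mul hab, ofReal_measureReal, ofReal_measureReal]
  rw [ENNReal.ofReal_le_ofReal_iff (by positivity)] at h5
  have h6 := probReal_compl_eq_one_sub (μ := law p) (measurableSet_edgeGE n (b * n))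
  have h7 : 0 ≤ (law p).real (edgeGE n (b * n))ᶜ := measureReal_nonneg
  have h8 : (law p).real (edgeGE n (b * n)) = 1 - (law p).real (edgeGE n (b * n))ᶜ := by linarith
  rw [h8] at h5
  nlinarith

open Filter Topology in
lemma tendsto_compl_edgeGE (h : slope p = (α : EReal)) (hα : 0 < α) {b : ℝ} (hbα : b < α) :
    Tendsto (fun n : ℕ => (law p).real (edgeGE n (b * n))ᶜ) atTop (𝓝 0) := by
  rw [Metric.tendsto_atTop]
  intro ε hε
  set b' := max b (α / 2) with hb'
  have hb'0 : 0 < b' := lt_max_of_lt_right (by linarith)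
  have hb'α : b' < α := max_lt hbα (by linarith)
  -- With `a = α + 2γ` and tail at most `γ`, the right side is `3γ = (α - b')ε/2`.
  set γ := ε * (α - b') / 6 with hγ
  have hγ0 : 0 < γ := by
    have : 0 < α - b' := by linarith
    positivity
  obtain ⟨t, C, ht, hC, hbound⟩ := exists_edgeGE_le h hα hγ0
  have hlim : Tendsto (fun n : ℕ => C * Real.exp (-(t * γ) * n)) atTop (𝓝 0) := by
    have h1 : Tendsto (fun n : ℕ => Real.exp (-(t * γ)) ^ n) atTop (𝓝 0) :=
      tendsto_pow_atTop_nhds_zero_of_lt_one (Real.exp_pos _).le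
        (Real.exp_lt_one_iff.2 (by have := mul_pos ht hγ0; linarith))
    have h2 := h1.const_mul C
    simp only [mul_zero] at h2
    refine h2.congr fun n => ?_
    rw [← Real.exp_nat_mul, mul_comm (n : ℝ)]
  obtain ⟨n₀, hn₀⟩ := (hlim.eventually_lt_const hγ0).exists_forall_of_atTop
  refine ⟨max n₀ 1, fun n hn => ?_⟩
  have hn1 : 1 ≤ n := (le_max_right _ _).trans hn
  have htail : (law p).real (edgeGE n ((α + 2 * γ) * n)) ≤ γ := by
    have h1 := hbound n (2 * γ * n)
    rw [show α * n + 2 * γ * n = (α + 2 * γ) * n by ring,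
      show t * (γ * n - 2 * γ * n) = -(t * γ) * n by ring] at h1
    exact (ENNReal.toReal_le_of_le_ofReal (by positivity) h1).trans
      (hn₀ n ((le_max_left _ _).trans hn)).le
  have hmain := real_compl_edgeGE_le h hb'0 hb'α (show α < α + 2 * γ by linarith) hn1
  have hmono : (law p).real (edgeGE n (b * n))ᶜ ≤ (law p).real (edgeGE n (b' * n))ᶜ := by
    refine measureReal_mono (Set.compl_subset_compl.2 ?_)
    rintro ω ⟨x, hx, hxr⟩
    refine ⟨x, hx, le_trans ?_ hxr⟩
    gcongr
    exact le_max_left _ _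
  rw [Real.dist_eq, sub_zero, abs_of_nonneg measureReal_nonneg]
  refine hmono.trans_lt ?_
  have h9 : (α - b') * (law p).real (edgeGE n (b' * n))ᶜ ≤ (α - b') * (ε / 2) := by
    calc _ ≤ α + 2 * γ - α + (law p).real (edgeGE n ((α + 2 * γ) * n)) := hmain
      _ ≤ 3 * γ := by linarith
      _ = _ := by rw [hγ]; ring
  have := le_of_mul_le_mul_left h9 (by linarith)
  linarith

end Slope

/-! ### Crossing probabilities -/

lemma Conn.connIn {ω : Config} {S : Set Site} {a b : Site} (h : Conn ω a b)
    (hS : ∀ s, Conn ω a s → Conn ω s b → s ∈ S) : ConnIn ω S a b := by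
  refine ⟨hS a .refl h, ?_⟩
  suffices ∀ c, Conn ω a c → Conn ω c b →
      Relation.ReflTransGen (fun x y => Step ω x y ∧ y ∈ S) a c from this b h .refl
  intro c hc
  induction hc with
  | refl => exact fun _ => .refl
  | tail had hde ih =>
    exact fun heb => (ih (.head hde heb)).tail ⟨hde, hS _ (.tail had hde) heb⟩

/-- The highest site of the column `n` whose height is at most `r`. -/
def siteBelow (n : ℕ) (r : ℝ) : Site :=
  ⟨(n, 2 * ⌊(r - n) / 2⌋ + n), by simp only; omega, by simp only [Int.even_iff]; omega⟩

lemma siteBelow_snd_le (n : ℕ) (r : ℝ) : ((siteBelow n r).1.2 : ℝ) ≤ r := by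
  have := Int.floor_le ((r - n) / 2)
  simp only [siteBelow]
  push_cast
  linarith

lemma lt_siteBelow_snd (n : ℕ) (r : ℝ) : r - 2 < (siteBelow n r).1.2 := by
  have := Int.lt_floor_add_one ((r - n) / 2)
  simp only [siteBelow]
  push_cast
  linarith

lemma snd_le_siteBelow {n : ℕ} {r : ℝ} {s : Site} (hs : s.1.1 = n) (hr : (s.1.2 : ℝ) ≤ r) :
    s.1.2 ≤ (siteBelow n r).1.2 := by
  have h1 := site_mod s
  have h2 : (s.1.2 - n) / 2 ≤ ⌊(r - n) / 2⌋ := by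
    rw [Int.le_floor]
    have h3 : 2 * ((s.1.2 - n) / 2) = s.1.2 - n := by omega
    have h4 : (2 : ℝ) * (((s.1.2 - n) / 2 : ℤ) : ℝ) = s.1.2 - n := by exact_mod_cast h3
    linarith
  simp only [siteBelow]
  omega

/-- If the process started from a half-line neither gets much above nor much below its asymptotic
line, then the block at the origin has a rising crossing. -/
lemma crossing_origin_of {δ α e : ℝ} {L N : ℕ} {ω : Config} (hN : (N : ℤ) = ⌊(1 + δ) * (L : ℝ)⌋)
    (hα : 0 < α) (hN2 : N ≤ 2 * L) (he : 0 < e) (hL : 3 * (e * L) + 2 ≤ 1 / 2 * (δ * α * L))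
    {c : Site} (hc : c = siteBelow 0 (-(δ * α * L)))
    (h₁ : ∀ n ≤ N, shift c ω ∉ edgeGE n (α * n + e * L))
    (h₂ : shift c ω ∈ edgeGE N ((α - e / 2) * N))
    (h₃ : ∀ n ≤ N, shift (siteBelow n (c.1.2 + α * n - 3 * (e * L))) ω ∉
      edgeGE (N - n) (α * (N - n : ℕ) + e * L)) :
    crossing 1 δ α L origin ω := by
  have hL0 : (0 : ℝ) ≤ L := Nat.cast_nonneg L
  have heL : 0 ≤ e * L := by positivity
  have hNr : (N : ℝ) ≤ 2 * L := by exact_mod_cast hN2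
  have hNL : (N : ℝ) ≤ (1 + δ) * L := by
    have h := Int.floor_le ((1 + δ) * (L : ℝ))
    rw [← hN] at h
    exact_mod_cast h
  have hc0 : c.1.1 = 0 := by rw [hc]; rfl
  have hc1 : (c.1.2 : ℝ) ≤ -(δ * α * L) := by rw [hc]; exact siteBelow_snd_le _ _
  have hc2 : -(δ * α * L) - 2 < c.1.2 := by rw [hc]; exact lt_siteBelow_snd _ _
  obtain ⟨x, ⟨a, b, ha, ha', hb, hab⟩, hx⟩ := h₂
  have hb1 : b.1.1 = N := by rw [hb]
  have hb2 : b.1.2 = x := by rw [hb]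
  have hab' := hab.translate
  have hxr : α * N - e * L ≤ x := by
    have : e * N ≤ e * (2 * L) := by gcongr
    linarith
  have hX : ∀ s, relX L origin s = s.1.1 := fun s => by simp [relX, origin]
  have hY : ∀ s, relY δ α L origin s = s.1.2 := fun s => by simp [relY, origin]
  have hin : ConnIn ω (strip 1 δ α L origin) (translate c a) (translate c b) := by
    refine hab'.connIn fun s hs hsb => ?_
    have hs1 := hs.fst_le
    have hs2 := hsb.fst_le
    have hs0 := s.2.1
    simp only [translate, hc0, hb1] at hs1 hs2
    obtain ⟨n, hn⟩ := Int.eq_ofNat_of_zero_le hs0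
    have hnN : n ≤ N := by omega
    have hnr : (s.1.1 : ℝ) = n := by rw [hn]; simp
    have hup : (s.1.2 : ℝ) - c.1.2 < α * n + e * L := by
      by_contra hcon
      refine h₁ n hnN ⟨s.1.2 - c.1.2, ⟨_, _, ?_, ?_, ?_,
        hs.untranslate (c := c) (by simp only [translate]; linarith [a.2.1])⟩, ?_⟩
      · simpa [untranslate, translate] using ha
      · simpa [untranslate, translate] using ha'
      · simp [untranslate, hc0, hn]
      · push_cast; linarith
    -- A path this low lies below `d`, so the rest of it is a path of the process restarted at `d`.
    -- Its endpoint is at least `α(N - n) + 2eL` above `d`, which `h₃` excludes.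
    have hlow : c.1.2 + α * n - 3 * (e * L) < (s.1.2 : ℝ) := by
      by_contra hcon
      set d := siteBelow n (c.1.2 + α * n - 3 * (e * L)) with hd
      have hd0 : d.1.1 = n := rfl
      have hd1 := siteBelow_snd_le n (c.1.2 + α * n - 3 * (e * L))
      rw [← hd] at hd1
      have hsd : s.1.2 ≤ d.1.2 := snd_le_siteBelow hn (not_lt.1 hcon)
      refine h₃ n hnN ⟨x + c.1.2 - d.1.2, ⟨_, _, ?_, ?_, ?_,
        hsb.untranslate (c := d) (by omega)⟩, ?_⟩
      · left; simp only [untranslate]; omega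
      · simp only [untranslate]; omega
      · simp only [untranslate, translate, hc0, hb1, hb2, hd0, Prod.mk.injEq, and_true]
        omega
      · push_cast [hnN]; linarith
    refine ⟨by rw [hX]; exact hs0, ?_, ?_, ?_⟩
    · rw [hX, hnr]
      have : (n : ℝ) ≤ N := by exact_mod_cast hnN
      linarith
    · rw [hX, hY, hnr]; push_cast; linarith
    · rw [hX, hY, hnr]; push_cast; linarith
  have hain := hin.1
  have hax : (0 : ℝ) ≤ α * ((translate c a).1.1 : ℤ) :=
    mul_nonneg hα.le (by exact_mod_cast (translate c a).2.1)
  refine ⟨translate c a, translate c b, ?_, ?_, ?_, ?_, hin⟩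
  · rw [hX]; simpa [translate, hc0] using ha
  · have h := hain.2.2.1
    rw [hX] at h
    linarith
  · rw [hY]
    have : (a.1.2 : ℝ) ≤ 0 := by exact_mod_cast ha'
    have hD : 0 ≤ δ * α * L := by linarith
    simp only [translate]
    push_cast
    linarith
  · rw [hX, ← hN]; simp [translate, hc0, hb1]

open Filter Topology in
lemma exists_crossing_origin_compl_le {p : unitInterval} {δ α : ℝ} (hδ : 0 < δ) (hδ' : δ < 0.25)
    (hα : 0 < α) (h : slope p = (α : EReal)) {ε : ℝ} (hε : 0 < ε) :
    ∃ L₀ : ℕ, ∀ L : ℕ, L₀ ≤ L → (law p).real {ω | crossing 1 δ α L origin ω}ᶜ ≤ ε := by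
  -- The deviations use `3eL = (3/16)δαL` of the half-width `(1/2)δαL`; the rest covers the rounding
  -- by `2` of the starting height once `δαL ≥ 8`.
  set e := δ * α / 16 with he
  have he0 : 0 < e := by positivity
  -- With `γ = e/4` and at most `2L` columns, the drift `γk ≤ eL/2` is half the margin `eL`. Each
  -- bad event then has probability of order `exp(-teL/2)`, which beats the union over `2L + 1`
  -- columns.
  obtain ⟨t, C, ht, hC, hbound⟩ := exists_edgeGE_le h hα (γ := e / 4) (by positivity)
  have hedge := tendsto_compl_edgeGE h hα (b := α - e / 2) (by linarith)
  obtain ⟨n₀, hn₀⟩ := (hedge.eventually_lt_const (half_pos hε)).exists_forall_of_atTop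
  have hlim : Tendsto (fun L : ℕ => 2 * ((2 * L + 1 : ℕ) * (C * Real.exp (-(t * e / 2) * L))))
      atTop (𝓝 0) := by
    have hr : Real.exp (-(t * e / 2)) < 1 :=
      Real.exp_lt_one_iff.2 (by have := mul_pos ht he0; linarith)
    have h1 := tendsto_self_mul_const_pow_of_lt_one (Real.exp_pos _).le hr
    have h2 := tendsto_pow_atTop_nhds_zero_of_lt_one (Real.exp_pos _).le hr
    have h3 := (h1.const_mul (4 * C)).add (h2.const_mul (2 * C))
    simp only [mul_zero, add_zero] at h3
    refine h3.congr fun L => ?_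
    rw [← Real.exp_nat_mul, mul_comm (L : ℝ) (-(t * e / 2))]
    push_cast
    ring
  obtain ⟨n₁, hn₁⟩ := (hlim.eventually_lt_const (half_pos hε)).exists_forall_of_atTop
  obtain ⟨n₂, hn₂⟩ := exists_nat_ge (8 / (δ * α))
  refine ⟨max n₀ (max n₁ n₂), fun L hL => ?_⟩
  obtain ⟨hL0, hL1, hL2⟩ : n₀ ≤ L ∧ n₁ ≤ L ∧ n₂ ≤ L := by
    simpa only [max_le_iff] using hL
  have hLn : (0 : ℝ) ≤ L := Nat.cast_nonneg L
  have hscale : 3 * (e * L) + 2 ≤ 1 / 2 * (δ * α * L) := by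
    have h1 : 8 / (δ * α) ≤ L := hn₂.trans (by exact_mod_cast hL2)
    rw [div_le_iff₀ (by positivity)] at h1
    rw [he]
    linarith
  obtain ⟨N, hN⟩ := Int.eq_ofNat_of_zero_le
    ((Nat.cast_nonneg L : (0 : ℤ) ≤ L).trans (floor_scale_bounds hδ L))
  have hLN : L ≤ N := by
    have := floor_scale_bounds hδ L
    omega
  have hN2 : N ≤ 2 * L := by
    have h1 := Int.floor_le ((1 + δ) * (L : ℝ))
    rw [hN] at h1
    have h2 : (N : ℝ) ≤ 2 * L := by
      have : ((N : ℤ) : ℝ) = N := by simp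
      nlinarith
    exact_mod_cast h2
  set c := siteBelow 0 (-(δ * α * L)) with hc
  set d : ℕ → Site := fun n => siteBelow n (c.1.2 + α * n - 3 * (e * L)) with hd
  let U : ℕ → Set Config := fun n => shift c ⁻¹' edgeGE n (α * n + e * L)
  let V : ℕ → Set Config := fun n =>
    shift (d n) ⁻¹' edgeGE (N - n) (α * (N - n : ℕ) + e * L)
  let W : Set Config := shift c ⁻¹' (edgeGE N ((α - e / 2) * N))ᶜ
  have hsub : {ω | crossing 1 δ α L origin ω}ᶜ ⊆
      ((⋃ n ∈ Finset.range (N + 1), U n) ∪ (⋃ n ∈ Finset.range (N + 1), V n)) ∪ W := by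
    intro ω hω
    by_contra hcon
    simp only [Set.mem_union, Set.mem_iUnion, Finset.mem_range, not_or, not_exists,
      Nat.lt_succ_iff] at hcon
    obtain ⟨⟨h1, h2⟩, h3⟩ := hcon
    exact hω (crossing_origin_of hN.symm hα hN2 he0 hscale hc h1 (not_not.1 h3) h2)
  have htail : ∀ (s : Site) (k : ℕ), k ≤ N →
      (law p).real (shift s ⁻¹' edgeGE k (α * k + e * L)) ≤
        C * Real.exp (-(t * e / 2) * L) := by
    intro s k hk
    rw [measureReal_def, (measurePreserving_shift p s).measure_preimage
      (measurableSet_edgeGE _ _).nullMeasurableSet]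
    refine ENNReal.toReal_le_of_le_ofReal (by positivity) ((hbound k (e * L)).trans ?_)
    refine ENNReal.ofReal_le_ofReal (mul_le_mul_of_nonneg_left (Real.exp_le_exp.2 ?_) hC.le)
    have h1 : (k : ℝ) ≤ 2 * L := by exact_mod_cast hk.trans hN2
    have h2 : e / 4 * k ≤ e / 4 * (2 * L) := by gcongr
    calc t * (e / 4 * k - e * L) ≤ t * (e / 4 * (2 * L) - e * L) := by gcongr
      _ = -(t * e / 2) * L := by ring
  have hsum : ∀ T : ℕ → Set Config,
      (∀ n ≤ N, (law p).real (T n) ≤ C * Real.exp (-(t * e / 2) * L)) →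
      (law p).real (⋃ n ∈ Finset.range (N + 1), T n) ≤
        (2 * L + 1 : ℕ) * (C * Real.exp (-(t * e / 2) * L)) := by
    intro T hT
    calc (law p).real (⋃ n ∈ Finset.range (N + 1), T n)
        ≤ ∑ n ∈ Finset.range (N + 1), (law p).real (T n) := measureReal_biUnion_finset_le _ _
      _ ≤ ∑ n ∈ Finset.range (N + 1), C * Real.exp (-(t * e / 2) * L) :=
          Finset.sum_le_sum fun n hn => hT n (by simpa [Nat.lt_succ_iff] using hn)
      _ = (N + 1 : ℕ) * (C * Real.exp (-(t * e / 2) * L)) := by simp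
      _ ≤ _ := by gcongr
  have hU := hsum U fun n hn => htail c n hn
  have hV := hsum V fun n _ => htail (d n) (N - n) (Nat.sub_le N n)
  have hW : (law p).real W ≤ ε / 2 := by
    rw [measureReal_def, (measurePreserving_shift p c).measure_preimage
      (measurableSet_edgeGE _ _).compl.nullMeasurableSet]
    exact (hn₀ N (hL0.trans hLN)).le
  have h1 := measureReal_mono (μ := law p) hsub
  have h2 := measureReal_union_le (μ := law p)
    ((⋃ n ∈ Finset.range (N + 1), U n) ∪ (⋃ n ∈ Finset.range (N + 1), V n)) W
  have h3 := measureReal_union_le (μ := law p)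
    (⋃ n ∈ Finset.range (N + 1), U n) (⋃ n ∈ Finset.range (N + 1), V n)
  have h4 := hn₁ L hL1
  linarith

lemma ConnIn.map {ω ω' : Config} {S T : Set Site} {φ : Site → Site}
    (hφ : ∀ a b, Step ω' a b → Step ω (φ a) (φ b)) (hST : ∀ a ∈ S, φ a ∈ T) {a b : Site}
    (h : ConnIn ω' S a b) : ConnIn ω T (φ a) (φ b) := by
  obtain ⟨ha, h⟩ := h
  refine ⟨hST a ha, ?_⟩
  induction h with
  | refl => exact .refl
  | tail _ hcd ih => exact ih.tail ⟨hφ _ _ hcd.1, hST _ hcd.2⟩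

lemma crossing_of_map {σ : ℤ} {δ α : ℝ} {L : ℕ} {z : Site} {ω : Config} {φ : Site → Site}
    (hφ : ∀ a b, Step (fun s => ω (φ s)) a b → Step ω (φ a) (φ b))
    (hX : ∀ a, relX L z (φ a) = relX L origin a)
    (hY : ∀ a, σ * relY δ α L z (φ a) = relY δ α L origin a)
    (h : crossing 1 δ α L origin fun s => ω (φ s)) : crossing σ δ α L z ω := by
  obtain ⟨a, b, h1, h2, h3, h4, h5⟩ := h
  simp only [Int.cast_one, one_mul] at h2 h3
  refine ⟨φ a, φ b, by rwa [hX], by rwa [hY], by rwa [hY], by rwa [hX], h5.map hφ fun s hs => ?_⟩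
  simpa only [strip, hX, hY, Int.cast_one, one_mul, Set.mem_ofPred_eq] using hs

/-- The probability of a crossing is at least that of a rising crossing of the block at the
origin. -/
lemma crossing_compl_le (p : unitInterval) {σ : ℤ} (hσ : σ = 1 ∨ σ = -1) {δ α : ℝ} {L : ℕ}
    (hL : Admissible δ α L) (z : Site) :
    (law p).real {ω | crossing σ δ α L z ω}ᶜ ≤
      (law p).real {ω | crossing 1 δ α L origin ω}ᶜ := by
  obtain ⟨-, hLe, K, hKe, hK⟩ := hL
  -- Admissibility enters here: as `L` and `K` are even, the base point of every block is a site.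
  let c : Site := ⟨(L * z.1.1, K * z.1.2), mul_nonneg (Nat.cast_nonneg L) z.2.1,
    ((hLe.natCast (α := ℤ)).mul_right _).add (hKe.mul_right _)⟩
  suffices ∃ φ : Site → Site, φ.Injective ∧
      (∀ (ω : Config) (a b : Site), Step (fun s => ω (φ s)) a b → Step ω (φ a) (φ b)) ∧
      (∀ a, relX L z (φ a) = relX L origin a) ∧
      (∀ a, σ * relY δ α L z (φ a) = relY δ α L origin a) by
    obtain ⟨φ, hinj, hφ, hX, hY⟩ := this
    have hm : MeasurableSet {ω | crossing 1 δ α L origin ω} :=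
      siteSigma_le _ _ (measurableSet_crossing 1 δ α L origin)
    have h := (measurePreserving_comp p hinj).measure_preimage hm.compl.nullMeasurableSet
    rw [measureReal_def, measureReal_def, ← h]
    refine ENNReal.toReal_mono (measure_ne_top _ _) (measure_mono fun ω hω hcon => hω ?_)
    exact crossing_of_map (hφ ω) hX hY hcon
  rcases hσ with rfl | rfl
  · refine ⟨translate c, translate_injective c, fun ω a b => step_shift_iff.1, fun a => ?_,
      fun a => ?_⟩
    · simp [relX, origin, translate, c]
    · simp [relY, origin, translate, c, hK]
  · refine ⟨translate c ∘ mirror, (translate_injective c).comp mirror_injective,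
      fun ω a b hab => ?_, fun a => ?_, fun a => ?_⟩
    · refine ⟨hab.1, ?_⟩
      simp only [Function.comp, translate, mirror, Prod.ext_iff]
      have h2 := hab.2
      simp only [Prod.ext_iff] at h2
      omega
    · simp [relX, origin, translate, mirror, c]
    · simp [relY, origin, translate, mirror, c, hK]

lemma exists_goodBlock_prob_gt {p : unitInterval} {δ α : ℝ} (hδ : 0 < δ) (hδ' : δ < 0.25)
    (hα : 0 < α) (h : slope p = (α : EReal)) {ε : ℝ} (hε : 0 < ε) :
    ∃ L₀ : ℕ, ∀ L : ℕ, L₀ ≤ L → Admissible δ α L → ∀ z : Site,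
      1 - ε < (law p).real {ω | eta δ α L z ω = 1} := by
  obtain ⟨L₀, hL₀⟩ := exists_crossing_origin_compl_le hδ hδ' hα h (ε := ε / 3) (by positivity)
  refine ⟨L₀, fun L hL hadm z => ?_⟩
  have heq : {ω | eta δ α L z ω = 1} =
      {ω | crossing 1 δ α L z ω} ∩ {ω | crossing (-1) δ α L z ω} := by
    ext ω; exact eta_eq_one_iff
  have hm : ∀ σ, MeasurableSet {ω | crossing σ δ α L z ω} := fun σ =>
    siteSigma_le _ _ (measurableSet_crossing σ δ α L z)
  have h1 := probReal_compl_eq_one_sub (μ := law p) ((hm 1).inter (hm (-1)))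
  rw [Set.compl_inter] at h1
  have h2 := measureReal_union_le (μ := law p) {ω | crossing 1 δ α L z ω}ᶜ
    {ω | crossing (-1) δ α L z ω}ᶜ
  have h3 := crossing_compl_le p (Or.inl rfl) hadm z
  have h4 := crossing_compl_le p (Or.inr rfl) hadm z
  have h5 := hL₀ L hL
  rw [heq]
  linarith

end OTSP

end

theorem mainTheorem10 (p : unitInterval) (δ α : ℝ) (hδ : 0 < δ) (hδ' : δ < 0.25)
    (hα : 0 < α) (hα' : α ≤ 1) :
    (∀ L : ℕ, OTSP.Admissible δ α L →
      -- 1-dependence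
      (∀ (m : ℕ) (z : Fin m → OTSP.Site),
        (∀ i j : Fin m, i ≠ j → 1 < OTSP.blockGraph.edist (z i) (z j)) →
        iIndepFun (fun i => OTSP.eta δ α L (z i)) (OTSP.law p)) ∧
      -- each block variable is independent of all but at most six others
      (∀ z : OTSP.Site, (OTSP.blockGraph.neighborSet z).encard ≤ 6 ∧
        IndepFun (OTSP.eta δ α L z)
          (fun (ω : OTSP.Config)
              (z' : {z' : OTSP.Site // z' ≠ z ∧ z' ∉ OTSP.blockGraph.neighborSet z}) =>
            OTSP.eta δ α L z'.1 ω)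
          (OTSP.law p)) ∧
      -- percolation of the block system forces an infinite cluster in the original model
      (∀ ω : OTSP.Config, (OTSP.etaCluster δ α L ω).Infinite →
        ∃ a : OTSP.Site, (a.1.1 = 0 ∨ a.1.1 = 1) ∧
          -(3 / 2) * δ * α * L ≤ (a.1.2 : ℝ) ∧ (a.1.2 : ℝ) ≤ -(1 / 2) * δ * α * L ∧
          (OTSP.cluster ω a).Infinite)) ∧
    -- at the slope of the model, blocks are good with probability close to one
    (OTSP.slope p = (α : EReal) → ∀ ε : ℝ, 0 < ε → ∃ L₀ : ℕ, ∀ L : ℕ, L₀ ≤ L →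
      OTSP.Admissible δ α L → ∀ z : OTSP.Site,
        1 - ε < (OTSP.law p).real {ω | OTSP.eta δ α L z ω = 1}) := by
  refine ⟨fun L hL => ⟨fun m z hz => OTSP.iIndepFun_eta p hδ hδ' hα hL z hz,
    fun z => ⟨OTSP.encard_neighborSet_le z, OTSP.indepFun_eta p hδ hδ' hα hL z⟩,
    fun ω hω => OTSP.exists_infinite_cluster hδ hδ' hα hα' hL hω⟩, fun h ε hε => ?_⟩
  exact OTSP.exists_goodBlock_prob_gt hδ hδ' hα h hε
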